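/- Let $\kappa$ and $\iota$ be probability measures on $\{0,1\}$ with $\iota(\{1\}) < \kappa(\{1\}) < 1$, and let $G$ be a free group of rank at least two (finite or infinite). Let $G$ act on $\{0,1\}^G$ by $(gx)(f) = x(g^{-1}f)$ for $x \in \{0,1\}^G$ and $g, f \in G$, and let $\kappa^G$ and $\iota^G$ be the product measures on $\{0,1\}^G$. Then there exists an equivariant thinning from $\kappa$ to $\iota$, that is, a measurable map $\phi : \{0,1\}^G \to \{0,1\}^G$ such that (i) $\phi(x)(g) \le x(g)$ for all $x \in \{0,1\}^G$ and all $g \in G$; (ii) the push-forward of $\kappa^G$ under $\phi$ is $\iota^G$; (iii) for $\kappa^G$-almost every $x$, $\phi(gx) = g\,\phi(x)$ for all $g \in G$. -/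

import Mathlib

open MeasureTheory

/-- The intensity `κ(1)` of a measure `κ` on `{0,1}`. -/
noncomputable def intensity (κ : Measure (Fin 2)) : ℝ := κ.real {1}

/-- The left translation action of `G` on `K^G`: `(g x)(f) = x(g⁻¹ f)`. -/
def shift {G K : Type*} [Group G] (g : G) (x : G → K) : G → K := fun f => x (g⁻¹ * f)

/-- The product measure `κ^G` of the Bernoulli shift over `G` with base `({0,1}, κ)`, on the
product `σ`-algebra. -/
noncomputable def bernoulliMeasure (G : Type*) (κ : Measure (Fin 2)) [IsProbabilityMeasure κ] :
    Measure (G → Fin 2) :=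
  Measure.infinitePi (fun _ : G => κ)

/-- `φ` is an equivariant thinning from `κ` to `ι` over the group `G`. -/
structure IsEquivariantThinning {G : Type*} [Group G] (κ ι : Measure (Fin 2))
    [IsProbabilityMeasure κ] [IsProbabilityMeasure ι]
    (φ : (G → Fin 2) → (G → Fin 2)) : Prop where
  measurable : Measurable φ
  thinning : ∀ (x : G → Fin 2) (g : G), φ x g ≤ x g
  map_eq : (bernoulliMeasure G κ).map φ = bernoulliMeasure G ι
  equivariant : ∀ᵐ x ∂(bernoulliMeasure G κ), ∀ g : G, φ (shift g x) = shift g (φ x)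

/-! Put `p = κ {1}` and `q = ι {1}`. With independent uniform labels at the sites the problem is
trivial: keep a one when its label lies in a set `A` of measure `q / p`. So the labels must be
manufactured from `x` itself, by an equivariant rule, and yet act as if they were independent of
`x`.

The randomness comes from switches. A marker pattern along `a`-lines singles out disjoint fillers;
when a filler carries exactly one one, at one of two adjacent distinguished positions, the choice of
position is a fair coin. Interchanging the two positions at any set of switches preserves `κ^G` and
the set of switches (`map_coinFlip`, `isSwitch_coinFlip`).

The thinned configuration must not reveal these coins, so sitewise thinning is corrected: a one at a
switch is always deleted. The lost ones are regained from other states of the filler, in which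
sitewise thinning deletes everything and some one at a distinguished position is restored. Both
states occupy the same fillers, are independent of the outside, and have equal probability for
suitable `k` and `T`, so trading them leaves the output law `ι^G` unchanged (`map_thin_univ`), while
for fixed labels the output is invariant under coin flips (`thin_coinFlip`).

One coin per switch must yield infinitely many bits per group element. Adding to each coin the next
one in direction `a`, respectively `b`, turns one family of fair coins into two independent ones.
This is the Ornstein–Weiss phenomenon: the Cayley tree has no cycles, so both sums can be prescribed
freely (`exists_coins_next`). Iteration gives independent labels at all sites (`map_seed`).

Finally `map_coinThinning` resamples the coins of `x`: the law of `x` and the output for given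
labels do not change, while the labels become independent of `x`. Everything is built by right
multiplication, hence commutes with left translation. -/

/-! ### Markers, switches and coin flips -/

section Marks

variable {G : Type*} [Group G]

/-- The point `h` is marked in `x` if along the line `h, h a, h a², …` the configuration `x` begins
with `k + 3` ones and a zero, and has another zero at the end of a window of length `2 k + 7`. The
positions `k + 4, …, 2 k + 5` of the window, on which no condition is imposed, form its filler. -/
def IsMarked (a : G) (k : ℕ) (x : G → Fin 2) (h : G) : Prop :=
  (∀ i ≤ k + 2, x (h * a ^ i) = 1) ∧ x (h * a ^ (k + 3)) = 0 ∧ x (h * a ^ (2 * k + 6)) = 0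

/-- The two distinguished positions in the filler of a marked point. -/
def src (k : ℕ) (β : Bool) : ℕ := bif β then k + 5 else k + 4

/-- A marked point is a switch if exactly one of the two distinguished positions in its filler
carries a one, and the rest of the filler carries zeros. -/
def IsSwitch (a : G) (k : ℕ) (x : G → Fin 2) (h : G) : Prop :=
  IsMarked a k x h ∧ x (h * a ^ src k false) ≠ x (h * a ^ src k true) ∧
    ∀ i ∈ Finset.Icc (k + 6) (2 * k + 5), x (h * a ^ i) = 0

open scoped Classical in
/-- Interchange the two distinguished positions at all switches `h` with `c h = 1`. -/
noncomputable def coinFlip (a : G) (k : ℕ) (x c : G → Fin 2) : G → Fin 2 := fun g =>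
  x g + ∑ β, if IsSwitch a k x (g * (a ^ src k β)⁻¹) then c (g * (a ^ src k β)⁻¹) else 0

lemma src_mem (k : ℕ) (β : Bool) : k + 4 ≤ src k β ∧ src k β ≤ k + 5 := by
  cases β <;> simp [src]

lemma src_injective (k : ℕ) : Function.Injective (src k) := by
  intro β γ; cases β <;> cases γ <;> simp [src]

variable {a : G} {k : ℕ} {x x' : G → Fin 2} {h h' : G}

/-- A filler meets no other marked window: if it did, a prescribed zero of one window would fall
into the initial run of `k + 3` ones of the other. The run is long enough for one of the two zeros
to do so whatever the offset. -/
lemma IsMarked.eq_of_mul_pow_eq (hx : IsMarked a k x h) (hx' : IsMarked a k x h') {i j : ℕ}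
    (hi : k + 4 ≤ i) (hi' : i ≤ 2 * k + 5) (hj : j ≤ 2 * k + 6) (e : h * a ^ i = h' * a ^ j) :
    h = h' := by
  rcases le_or_gt j i with hji | hji
  · obtain ⟨d, rfl⟩ := Nat.exists_eq_add_of_le hji
    have e' : h' = h * a ^ d := by
      rw [add_comm, pow_add, ← mul_assoc] at e
      exact (mul_right_cancel e).symm
    rcases Nat.eq_zero_or_pos d with rfl | hd
    · simpa using e'.symm
    exfalso
    rcases le_or_gt d (k + 3) with hd' | hd'
    · have h1 := hx'.1 (k + 3 - d) (by omega)
      rw [e', mul_assoc, ← pow_add, Nat.add_sub_cancel' hd', hx.2.1] at h1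
      exact absurd h1 (by decide)
    · have h1 := hx'.1 (2 * k + 6 - d) (by omega)
      rw [e', mul_assoc, ← pow_add, Nat.add_sub_cancel' (by omega), hx.2.2] at h1
      exact absurd h1 (by decide)
  · obtain ⟨d, rfl⟩ := Nat.exists_eq_add_of_le hji.le
    have e' : h = h' * a ^ d := by
      rw [add_comm, pow_add, ← mul_assoc] at e
      exact mul_right_cancel e
    exfalso
    have h1 := hx.1 (k + 3 - d) (by omega)
    rw [e', mul_assoc, ← pow_add, Nat.add_sub_cancel' (by omega), hx'.2.1] at h1
    exact absurd h1 (by decide)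

/-- The positions that decide whether a point is marked lie in no filler, so changes inside fillers
create and destroy no marks. For the converse direction, the owners of the fillers are first seen to
stay marked in `x'`, and disjointness is then used in `x'`. -/
lemma isMarked_iff_of_eq_off_filler (ha : Function.Injective (fun i : ℕ => a ^ i))
    (H : ∀ g, x' g ≠ x g → ∃ h i, IsMarked a k x h ∧ k + 4 ≤ i ∧ i ≤ 2 * k + 5 ∧ g = h * a ^ i)
    (h : G) : IsMarked a k x' h ↔ IsMarked a k x h := by
  have inj : ∀ {h : G} {i j : ℕ}, h * a ^ i = h * a ^ j → i = j :=
    fun e => ha (mul_left_cancel e)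
  have mp : ∀ h, IsMarked a k x h → IsMarked a k x' h := by
    intro h hh
    have key : ∀ i ≤ 2 * k + 6, (i ≤ k + 3 ∨ i = 2 * k + 6) → x' (h * a ^ i) = x (h * a ^ i) := by
      intro i hi hi'
      by_contra hne
      obtain ⟨h₁, j, hm, hj, hj', e⟩ := H _ hne
      obtain rfl := hm.eq_of_mul_pow_eq hh hj hj' hi e.symm
      have := inj e
      omega
    refine ⟨fun i hi => ?_, ?_, ?_⟩
    · rw [key i (by omega) (by omega)]; exact hh.1 i hi
    · rw [key _ (by omega) (by omega)]; exact hh.2.1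
    · rw [key _ (by omega) (by omega)]; exact hh.2.2
  refine ⟨fun hh => ?_, mp h⟩
  have key : ∀ i ≤ 2 * k + 6, (i ≤ k + 3 ∨ i = 2 * k + 6) → x' (h * a ^ i) = x (h * a ^ i) := by
    intro i hi hi'
    by_contra hne
    obtain ⟨h₁, j, hm, hj, hj', e⟩ := H _ hne
    obtain rfl := (mp _ hm).eq_of_mul_pow_eq hh hj hj' hi e.symm
    have := inj e
    omega
  refine ⟨fun i hi => ?_, ?_, ?_⟩
  · rw [← key i (by omega) (by omega)]; exact hh.1 i hi
  · rw [← key _ (by omega) (by omega)]; exact hh.2.1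
  · rw [← key _ (by omega) (by omega)]; exact hh.2.2

open scoped Classical in
lemma coinFlip_mul_pow (ha : Function.Injective (fun i : ℕ => a ^ i)) (c : G → Fin 2)
    (hx : IsMarked a k x h) {i : ℕ} (hi : i ≤ 2 * k + 6) :
    coinFlip a k x c (h * a ^ i) =
      x (h * a ^ i) + ∑ β, if i = src k β ∧ IsSwitch a k x h then c h else 0 := by
  unfold coinFlip
  congr 1
  refine Finset.sum_congr rfl fun β _ => ?_
  have hβ := src_mem k β
  by_cases hs : IsSwitch a k x (h * a ^ i * (a ^ src k β)⁻¹)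
  · have e : h * a ^ i * (a ^ src k β)⁻¹ = h :=
      hs.1.eq_of_mul_pow_eq (i := src k β) (j := i) hx (by omega) (by omega) hi (by group)
    have e' : i = src k β := ha (mul_left_cancel (mul_inv_eq_iff_eq_mul.1 e))
    rw [e] at hs ⊢
    simp [e', hs]
  · rw [if_neg hs, if_neg]
    rintro ⟨rfl, h2⟩
    exact hs (by simpa using h2)

lemma coinFlip_eq_off_filler (c : G → Fin 2) (g : G) (hg : coinFlip a k x c g ≠ x g) :
    ∃ h i, IsMarked a k x h ∧ k + 4 ≤ i ∧ i ≤ 2 * k + 5 ∧ g = h * a ^ i := by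
  by_contra H
  apply hg
  unfold coinFlip
  rw [Finset.sum_eq_zero, add_zero]
  intro β _
  rw [if_neg]
  intro hs
  have := src_mem k β
  exact H ⟨_, src k β, hs.1, by omega, by omega, by group⟩

lemma isMarked_coinFlip (ha : Function.Injective (fun i : ℕ => a ^ i)) (c : G → Fin 2) :
    IsMarked a k (coinFlip a k x c) h ↔ IsMarked a k x h :=
  isMarked_iff_of_eq_off_filler ha (coinFlip_eq_off_filler c) h

lemma isSwitch_coinFlip (ha : Function.Injective (fun i : ℕ => a ^ i)) (c : G → Fin 2) :
    IsSwitch a k (coinFlip a k x c) h ↔ IsSwitch a k x h := by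
  classical
  unfold IsSwitch
  rw [isMarked_coinFlip ha]
  refine and_congr_right fun hm => ?_
  have h0 := src_mem k false
  have h1 := src_mem k true
  rw [coinFlip_mul_pow ha c hm (by omega), coinFlip_mul_pow ha c hm (by omega)]
  refine and_congr ?_ ?_
  · simp [(src_injective k).eq_iff]
  · refine forall₂_congr fun i hi => ?_
    rw [Finset.mem_Icc] at hi
    rw [coinFlip_mul_pow ha c hm (by omega), Finset.sum_eq_zero, add_zero]
    intro β _
    have := src_mem k β
    rw [if_neg (by omega)]

lemma coinFlip_mul_pow_src (ha : Function.Injective (fun i : ℕ => a ^ i)) (c : G → Fin 2)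
    (hx : IsSwitch a k x h) (β : Bool) :
    coinFlip a k x c (h * a ^ src k β) = x (h * a ^ src k β) + c h := by
  classical
  have := src_mem k β
  rw [coinFlip_mul_pow ha c hx.1 (by omega)]
  simp [(src_injective k).eq_iff, hx]

lemma coinFlip_coinFlip (ha : Function.Injective (fun i : ℕ => a ^ i)) (c c' : G → Fin 2) :
    coinFlip a k (coinFlip a k x c) c' = coinFlip a k x (c + c') := by
  classical
  ext1 g
  simp only [coinFlip.eq_1 a k (coinFlip a k x c) c', isSwitch_coinFlip ha]
  simp only [coinFlip, add_assoc, ← Finset.sum_add_distrib]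
  congr 1
  refine Finset.sum_congr rfl fun β _ => ?_
  split_ifs <;> simp

/-- Flipping a single coin permutes coordinates. -/
lemma coinFlip_single [DecidableEq G] (ha : Function.Injective (fun i : ℕ => a ^ i)) (h : G)
    (hx : IsSwitch a k x h) :
    coinFlip a k x (Pi.single h 1) =
      x ∘ Equiv.swap (h * a ^ src k false) (h * a ^ src k true) := by
  classical
  have hne : h * a ^ src k false ≠ h * a ^ src k true := fun e =>
    absurd (src_injective k (ha (mul_left_cancel e))) (by decide)
  -- Adding one to two different bits interchanges them.
  have two : ∀ u v : Fin 2, u ≠ v → u + 1 = v := by decide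
  ext1 g
  by_cases h0 : g = h * a ^ src k false
  · subst h0
    rw [coinFlip_mul_pow_src ha _ hx]
    simpa using two _ _ hx.2.1
  by_cases h1 : g = h * a ^ src k true
  · subst h1
    rw [coinFlip_mul_pow_src ha _ hx]
    simpa using two _ _ hx.2.1.symm
  · rw [Function.comp_apply, Equiv.swap_apply_of_ne_of_ne h0 h1]
    simp only [coinFlip]
    rw [Finset.sum_eq_zero, add_zero]
    intro β _
    have : g * (a ^ src k β)⁻¹ ≠ h := by
      intro e
      rw [mul_inv_eq_iff_eq_mul] at e
      cases β
      · exact h0 e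
      · exact h1 e
    simp [Pi.single_eq_of_ne this]

lemma coinFlip_single_of_not [DecidableEq G] (h : G) (hx : ¬ IsSwitch a k x h) (v : Fin 2) :
    coinFlip a k x (Pi.single h v) = x := by
  ext1 g
  simp only [coinFlip]
  rw [Finset.sum_eq_zero, add_zero]
  intro β _
  split_ifs with hs
  · rw [Pi.single_eq_of_ne]
    rintro rfl
    exact hx hs
  · rfl

@[simp] lemma coinFlip_zero : coinFlip a k x 0 = x := by
  ext1 g
  simp [coinFlip]

end Marks

/-! ### Sitewise thinning and its correction at marked fillers -/

section SiteThin

variable {G R : Type*}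

open scoped Classical in
/-- Sitewise thinning: a one of the configuration is kept if its label lies in `A`. -/
noncomputable def siteThin (A : Set R) (ω : G → Fin 2 × R) (g : G) : Fin 2 :=
  if (ω g).1 = 1 ∧ (ω g).2 ∈ A then 1 else 0

variable {A : Set R} {ω ω' : G → Fin 2 × R} {g : G}

lemma siteThin_congr (e : ω' g = ω g) : siteThin A ω' g = siteThin A ω g := by
  unfold siteThin
  congr 1
  rw [e]

lemma siteThin_eq_zero_of_fst (hg : (ω g).1 = 0) : siteThin A ω g = 0 := by
  simp [siteThin, hg]

end SiteThin

section Thin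

variable {G R : Type*} [Group G]

/-- The filler of `h` carries a single one, at the distinguished position `src k β`, and sitewise
thinning keeps it. -/
def IsKept (a : G) (k : ℕ) (A : Set R) (ω : G → Fin 2 × R) (h : G) (β : Bool) : Prop :=
  ((ω (h * a ^ src k β)).1 = 1 ∧ (ω (h * a ^ src k β)).2 ∈ A) ∧
    (ω (h * a ^ src k (!β))).1 = 0 ∧ ∀ i ∈ Finset.Icc (k + 6) (2 * k + 5), (ω (h * a ^ i)).1 = 0

/-- The filler of `h` carries a one at `src k β`, a zero at the other distinguished position with
label in `T`, at least one other one, and sitewise thinning removes all ones from the filler. -/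
def IsRemoved (a : G) (k : ℕ) (A T : Set R) (ω : G → Fin 2 × R) (h : G) (β : Bool) : Prop :=
  ((ω (h * a ^ src k β)).1 = 1 ∧ (ω (h * a ^ src k β)).2 ∉ A) ∧
    ((ω (h * a ^ src k (!β))).1 = 0 ∧ (ω (h * a ^ src k (!β))).2 ∈ T) ∧
    (∀ i ∈ Finset.Icc (k + 6) (2 * k + 5), siteThin A ω (h * a ^ i) = 0) ∧
    ¬ ∀ i ∈ Finset.Icc (k + 6) (2 * k + 5), (ω (h * a ^ i)).1 = 0

/-- The decision of sitewise thinning at `h * a ^ src k β` is to be reversed. -/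
def IsToggle (a : G) (k : ℕ) (A T : Set R) (ω : G → Fin 2 × R) (h : G) (β : Bool) : Prop :=
  IsMarked a k (fun g => (ω g).1) h ∧ (IsKept a k A ω h β ∨ IsRemoved a k A T ω h β)

open scoped Classical in
/-- Sitewise thinning, with the decisions reversed at the toggles in `D`. -/
noncomputable def thin (a : G) (k : ℕ) (A T : Set R) (D : Set (G × Bool)) (ω : G → Fin 2 × R) :
    G → Fin 2 := fun g =>
  siteThin A ω g + ∑ β, if (g * (a ^ src k β)⁻¹, β) ∈ D ∧
    IsToggle a k A T ω (g * (a ^ src k β)⁻¹) β then 1 else 0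

/-- The filler of `h`. -/
def filler (a : G) (k : ℕ) (h : G) : Set G :=
  {g | ∃ i, k + 4 ≤ i ∧ i ≤ 2 * k + 5 ∧ g = h * a ^ i}

open scoped Classical in
/-- Erase the configuration and the labels on the filler of `h`. -/
noncomputable def eraseFiller [Inhabited R] (a : G) (k : ℕ) (h : G) (ω : G → Fin 2 × R) :
    G → Fin 2 × R := fun g => if g ∈ filler a k h then (0, default) else ω g

variable {a : G} {k : ℕ} {A T : Set R} {D : Set (G × Bool)} {ω ω' : G → Fin 2 × R} {h g : G}
  {β : Bool}

lemma IsToggle.fst_eq_one (ht : IsToggle a k A T ω h β) : (ω (h * a ^ src k β)).1 = 1 :=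
  ht.2.elim (fun h => h.1.1) (fun h => h.1.1)

lemma thin_eq_zero_of_fst (hg : (ω g).1 = 0) : thin a k A T D ω g = 0 := by
  rw [thin, siteThin_eq_zero_of_fst hg, zero_add]
  refine Finset.sum_eq_zero fun β _ => ?_
  rw [if_neg]
  rintro ⟨-, ht⟩
  have := ht.fst_eq_one
  rw [inv_mul_cancel_right, hg] at this
  exact absurd this (by decide)

lemma thin_le (g : G) : thin a k A T D ω g ≤ (ω g).1 := by
  have two : ∀ u : Fin 2, u = 0 ∨ u = 1 := by decide
  rcases two (ω g).1 with h | h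
  · rw [thin_eq_zero_of_fst h]; exact Fin.zero_le _
  · rw [h]; exact Fin.le_last _

lemma thin_empty : thin a k A T ∅ ω = siteThin A ω := by
  ext1 g; simp [thin]

lemma isToggle_congr
    (hm : IsMarked a k (fun g => (ω' g).1) h ↔ IsMarked a k (fun g => (ω g).1) h)
    (H : IsMarked a k (fun g => (ω g).1) h → ∀ i, k + 4 ≤ i → i ≤ 2 * k + 5 →
      ω' (h * a ^ i) = ω (h * a ^ i)) :
    IsToggle a k A T ω' h β ↔ IsToggle a k A T ω h β := by
  unfold IsToggle
  rw [hm]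
  refine and_congr_right fun hx => ?_
  have H := H hx
  have h0 := src_mem k β
  have h1 := src_mem k (!β)
  have hk : ∀ i ∈ Finset.Icc (k + 6) (2 * k + 5), ω' (h * a ^ i) = ω (h * a ^ i) := by
    intro i hi
    rw [Finset.mem_Icc] at hi
    exact H i (by omega) (by omega)
  have e0 : ω' (h * a ^ src k β) = ω (h * a ^ src k β) := H _ (by omega) (by omega)
  have e1 : ω' (h * a ^ src k (!β)) = ω (h * a ^ src k (!β)) := H _ (by omega) (by omega)
  have e2 : (∀ i ∈ Finset.Icc (k + 6) (2 * k + 5), (ω' (h * a ^ i)).1 = 0) ↔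
      ∀ i ∈ Finset.Icc (k + 6) (2 * k + 5), (ω (h * a ^ i)).1 = 0 :=
    forall₂_congr fun i hi => by rw [hk i hi]
  have e3 : (∀ i ∈ Finset.Icc (k + 6) (2 * k + 5), siteThin A ω' (h * a ^ i) = 0) ↔
      ∀ i ∈ Finset.Icc (k + 6) (2 * k + 5), siteThin A ω (h * a ^ i) = 0 :=
    forall₂_congr fun i hi => by rw [siteThin_congr (hk i hi)]
  simp only [IsKept, IsRemoved, e0, e1, e2, e3]

open scoped Classical in
lemma thin_mul_pow (ha : Function.Injective (fun i : ℕ => a ^ i))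
    (hx : IsMarked a k (fun g => (ω g).1) h) {i : ℕ} (hi : i ≤ 2 * k + 6) :
    thin a k A T D ω (h * a ^ i) = siteThin A ω (h * a ^ i) +
      ∑ β, if i = src k β ∧ (h, β) ∈ D ∧ IsToggle a k A T ω h β then 1 else 0 := by
  unfold thin
  congr 1
  refine Finset.sum_congr rfl fun β _ => ?_
  have hβ := src_mem k β
  by_cases hs : IsToggle a k A T ω (h * a ^ i * (a ^ src k β)⁻¹) β
  · have e : h * a ^ i * (a ^ src k β)⁻¹ = h :=
      hs.1.eq_of_mul_pow_eq (i := src k β) (j := i) hx (by omega) (by omega) hi (by group)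
    have e' : i = src k β := ha (mul_left_cancel (mul_inv_eq_iff_eq_mul.1 e))
    rw [e] at hs ⊢
    simp [e', hs]
  · rw [if_neg (fun h => hs h.2), if_neg]
    rintro ⟨rfl, h2⟩
    exact hs (by simpa using h2.2)

/-- This is what hides the coin: the one of a switch is toggled exactly when sitewise thinning would
keep it. `IsRemoved` cannot interfere, as it asks for a further one in the filler. -/
lemma thin_eq_zero_of_isSwitch (ha : Function.Injective (fun i : ℕ => a ^ i))
    (hx : IsSwitch a k (fun g => (ω g).1) h) (β : Bool) :
    thin a k A T Set.univ ω (h * a ^ src k β) = 0 := by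
  classical
  have h0 := src_mem k β
  obtain ⟨hm, hne, hK⟩ := hx
  have two : ∀ u : Fin 2, u ≠ 0 → u = 1 := by decide
  by_cases h1 : (ω (h * a ^ src k β)).1 = 0
  · exact thin_eq_zero_of_fst h1
  have h1' := two _ h1
  have h2 : (ω (h * a ^ src k (!β))).1 = 0 := by
    by_contra h2
    have h2' := two _ h2
    cases β
    · exact hne (h1'.trans h2'.symm)
    · exact hne (h2'.trans h1'.symm)
  rw [thin_mul_pow ha hm (by omega)]
  have : IsToggle a k A T ω h β ↔ (ω (h * a ^ src k β)).2 ∈ A := by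
    constructor
    · rintro ⟨-, ht | ht⟩
      · exact ht.1.2
      · exact absurd hK ht.2.2.2
    · exact fun hA => ⟨hm, Or.inl ⟨⟨h1', hA⟩, h2, hK⟩⟩
  rw [Finset.sum_eq_single β]
  · rw [siteThin]
    by_cases hA : (ω (h * a ^ src k β)).2 ∈ A <;> simp [hA, h1', this]
  · intro γ _ hγ
    rw [if_neg]
    rintro ⟨e, -⟩
    exact hγ (src_injective k e).symm
  · simp

/-- At the distinguished positions of switches both sides vanish; elsewhere neither the
configuration nor the filler that decides on a toggle has changed. -/
lemma thin_coinFlip (ha : Function.Injective (fun i : ℕ => a ^ i)) (x c : G → Fin 2) (u : G → R) :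
    thin a k A T Set.univ (fun g => (coinFlip a k x c g, u g)) =
      thin a k A T Set.univ (fun g => (x g, u g)) := by
  classical
  ext1 g
  by_cases hs : ∃ β, IsSwitch a k x (g * (a ^ src k β)⁻¹)
  · obtain ⟨β, hβ⟩ := hs
    have e : g * (a ^ src k β)⁻¹ * a ^ src k β = g := by group
    have h1 := thin_eq_zero_of_isSwitch (A := A) (T := T) (ω := fun g => (x g, u g)) ha hβ β
    have h2 := thin_eq_zero_of_isSwitch (A := A) (T := T)
      (ω := fun g => (coinFlip a k x c g, u g)) ha ((isSwitch_coinFlip ha c).2 hβ) β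
    rw [e] at h1 h2
    rw [h1, h2]
  · push Not at hs
    have hg : coinFlip a k x c g = x g := by
      simp only [coinFlip]
      rw [Finset.sum_eq_zero, add_zero]
      intro β _
      rw [if_neg (hs β)]
    unfold thin
    congr 1
    · simp only [siteThin, hg]
    refine Finset.sum_congr rfl fun β _ => ?_
    rw [isToggle_congr (ω := fun g => (x g, u g)) (isMarked_coinFlip ha c)]
    intro hm i hi hi'
    simp only [coinFlip_mul_pow ha c hm (show i ≤ 2 * k + 6 by omega)]
    rw [Finset.sum_eq_zero, add_zero]
    intro γ _
    rw [if_neg (fun h => hs β h.2)]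

/-- Locality in the coset `g H`; it allows restriction to countably many sites when the rank is
uncountable. -/
lemma thin_congr_of_subgroup (H : Subgroup G) (haH : a ∈ H)
    (e : ∀ h ∈ H, ω' (g * h) = ω (g * h)) :
    thin a k A T D ω' g = thin a k A T D ω g := by
  have e' : ∀ β i, ω' (g * (a ^ src k β)⁻¹ * a ^ i) = ω (g * (a ^ src k β)⁻¹ * a ^ i) := by
    intro β i
    rw [mul_assoc]
    exact e _ (H.mul_mem (H.inv_mem (H.pow_mem haH _)) (H.pow_mem haH _))
  unfold thin
  congr 1
  · have := e 1 H.one_mem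
    rw [mul_one] at this
    exact siteThin_congr this
  · refine Finset.sum_congr rfl fun β _ => ?_
    rw [isToggle_congr]
    · simp only [IsMarked, e']
    · intro _ i _ _
      exact e' β i

lemma thin_src_of_isToggle (ha : Function.Injective (fun i : ℕ => a ^ i))
    (ht : IsToggle a k A T ω h β) [Decidable ((h, β) ∈ D)] :
    thin a k A T D ω (h * a ^ src k β) =
      siteThin A ω (h * a ^ src k β) + if (h, β) ∈ D then 1 else 0 := by
  classical
  have hβ := src_mem k β
  rw [thin_mul_pow ha ht.1 (by omega)]
  congr 1
  rw [Finset.sum_eq_single β]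
  · simp [ht]
  · intro γ _ hγ
    rw [if_neg]
    rintro ⟨e, -⟩
    exact hγ (src_injective k e).symm
  · simp

lemma thin_insert_of_not_isToggle (ht : ¬ IsToggle a k A T ω h β) :
    thin a k A T (insert (h, β) D) ω = thin a k A T D ω := by
  classical
  ext1 g
  unfold thin
  congr 1
  refine Finset.sum_congr rfl fun γ _ => ?_
  congr 1
  rw [eq_iff_iff]
  refine and_congr_left fun h1 => ?_
  rw [Set.mem_insert_iff, or_iff_right]
  rintro e
  obtain ⟨h2, h3⟩ := Prod.mk.inj e
  rw [h2, h3] at h1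
  exact ht h1

section Erase

variable [Inhabited R]

lemma eraseFiller_of_notMem (hg : g ∉ filler a k h) : eraseFiller a k h ω g = ω g := if_neg hg

lemma isMarked_eraseFiller (ha : Function.Injective (fun i : ℕ => a ^ i)) (h' : G)
    (hx : IsMarked a k (fun g => (ω g).1) h) :
    IsMarked a k (fun g => (eraseFiller a k h ω g).1) h' ↔ IsMarked a k (fun g => (ω g).1) h' := by
  refine isMarked_iff_of_eq_off_filler ha (fun g hg => ?_) h'
  have : g ∈ filler a k h := by
    by_contra hg'
    exact hg (by rw [eraseFiller_of_notMem hg'])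
  obtain ⟨i, h1, h2, h3⟩ := this
  exact ⟨h, i, hx, h1, h2, h3⟩

lemma isMarked_eraseFiller_self (ha : Function.Injective (fun i : ℕ => a ^ i)) :
    IsMarked a k (fun g => (eraseFiller a k h ω g).1) h ↔ IsMarked a k (fun g => (ω g).1) h := by
  have key : ∀ i, (i ≤ k + 3 ∨ i = 2 * k + 6) → eraseFiller a k h ω (h * a ^ i) = ω (h * a ^ i) := by
    intro i hi
    apply eraseFiller_of_notMem
    rintro ⟨j, h1, h2, h3⟩
    have := ha (mul_left_cancel h3)
    omega
  unfold IsMarked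
  beta_reduce
  rw [key (k + 3) (by omega), key (2 * k + 6) (by omega)]
  refine and_congr_left fun _ => forall₂_congr fun i hi => ?_
  rw [key i (by omega)]

/-- At a marked `h` whose filler is in the `IsKept` or `IsRemoved` state, thinning is determined by
the data outside the filler, except at the distinguished position. -/
lemma thin_eq_update [DecidableEq G] (ha : Function.Injective (fun i : ℕ => a ^ i))
    (D' : Set (G × Bool)) (hD : ∀ p, p ≠ (h, β) → (p ∈ D' ↔ p ∈ D)) (ht : IsToggle a k A T ω h β)
    {v : Fin 2} (hv : thin a k A T D' ω (h * a ^ src k β) = v) :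
    thin a k A T D' ω =
      Function.update (thin a k A T D (eraseFiller a k h ω)) (h * a ^ src k β) v := by
  classical
  have hβ := src_mem k β
  ext1 g
  by_cases hg : g = h * a ^ src k β
  · rw [hg, Function.update_self, hv]
  rw [Function.update_of_ne hg]
  by_cases hF : g ∈ filler a k h
  · have h0 : (eraseFiller a k h ω g).1 = 0 := by simp [eraseFiller, hF]
    rw [thin_eq_zero_of_fst h0]
    obtain ⟨i, hi, hi', rfl⟩ := hF
    have hne : i ≠ src k β := by rintro rfl; exact hg rfl
    by_cases h1 : i = src k (!β)
    · apply thin_eq_zero_of_fst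
      rw [h1]
      exact ht.2.elim (fun h => h.2.1) (fun h => h.2.1.1)
    have hK : i ∈ Finset.Icc (k + 6) (2 * k + 5) := by
      rw [Finset.mem_Icc]
      cases β <;> simp [src] at hne h1 <;> omega
    rw [thin_mul_pow ha ht.1 (by omega), Finset.sum_eq_zero, add_zero]
    · exact ht.2.elim (fun h => siteThin_eq_zero_of_fst (h.2.2 i hK)) (fun h => h.2.2.1 i hK)
    · intro γ _
      have hγ := src_mem k γ
      rw [Finset.mem_Icc] at hK
      rw [if_neg]
      omega
  · unfold thin
    congr 1
    · exact (siteThin_congr (eraseFiller_of_notMem hF)).symm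
    refine Finset.sum_congr rfl fun γ _ => ?_
    have hγ := src_mem k γ
    have hne : g * (a ^ src k γ)⁻¹ ≠ h := by
      intro e
      by_cases hc : src k γ ≤ 2 * k + 5
      · exact hF ⟨src k γ, by omega, hc, mul_inv_eq_iff_eq_mul.1 e⟩
      · omega
    rw [hD _ (fun e => hne (congrArg Prod.fst e)),
      isToggle_congr (isMarked_eraseFiller ha _ ht.1)]
    intro hm i hi hi'
    apply eraseFiller_of_notMem
    rintro ⟨j, hj, hj', e⟩
    exact hne (hm.eq_of_mul_pow_eq ht.1 hi hi' (by omega) e)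

end Erase

end Thin

/-! ### Independence, interchange of events, and coordinate measurability -/

section General

lemma indep_iSup_comap_eval_infinitePi {ι : Type*} {E : ι → Type*} [∀ i, MeasurableSpace (E i)]
    (μ : ∀ i, Measure (E i)) [∀ i, IsProbabilityMeasure (μ i)] (S : Set ι) :
    ProbabilityTheory.Indep
      (⨆ i ∈ S, MeasurableSpace.comap (fun ω : ∀ i, E i => ω i) inferInstance)
      (⨆ i ∈ Sᶜ, MeasurableSpace.comap (fun ω : ∀ i, E i => ω i) inferInstance)
      (Measure.infinitePi μ) :=
  ProbabilityTheory.indep_iSup_of_disjoint (fun i => (measurable_pi_apply i).comap_le)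
    (ProbabilityTheory.iIndepFun_infinitePi (P := μ) (X := fun _ e => e)
      (fun _ => measurable_id)).iIndep disjoint_compl_right

/-- Interchanging the values at one coordinate on two events that look alike from the outside
does not change the law of a random configuration. -/
lemma map_eq_map_of_interchange {Ω G : Type*} [MeasurableSpace Ω] [DecidableEq G] {m : Measure Ω}
    {Y Y' Z : Ω → G → Fin 2} (hY : Measurable Y) (hY' : Measurable Y')
    {A B : Set Ω} (hA : MeasurableSet A) (hB : MeasurableSet B) (hAB : Disjoint A B)
    (off : ∀ ω, ω ∉ A → ω ∉ B → Y' ω = Y ω) (s : G)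
    (hYA : ∀ ω ∈ A, Y ω = Function.update (Z ω) s 1)
    (hYA' : ∀ ω ∈ A, Y' ω = Function.update (Z ω) s 0)
    (hYB : ∀ ω ∈ B, Y ω = Function.update (Z ω) s 0)
    (hYB' : ∀ ω ∈ B, Y' ω = Function.update (Z ω) s 1)
    (hm : ∀ C, MeasurableSet C → m (A ∩ Z ⁻¹' C) = m (B ∩ Z ⁻¹' C)) :
    m.map Y' = m.map Y := by
  have hup : ∀ v : Fin 2, Measurable (fun z : G → Fin 2 => Function.update z s v) := fun v =>
    measurable_update_left
  ext C hC
  rw [Measure.map_apply hY hC, Measure.map_apply hY' hC]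
  have dec : ∀ P : Set Ω, m P = m (A ∩ P) + m (B ∩ P) + m ((P \ A) \ B) := by
    intro P
    rw [← measure_inter_add_sdiff P hA, ← measure_inter_add_sdiff (P \ A) hB, ← add_assoc]
    congr 3
    · exact Set.inter_comm _ _
    · ext ω
      simp only [Set.mem_inter_iff, Set.mem_sdiff]
      have : ω ∈ A → ω ∉ B := fun h => Set.disjoint_left.1 hAB h
      tauto
  have pre : ∀ {W : Ω → G → Fin 2} {Q : Set Ω} {v : Fin 2},
      (∀ ω ∈ Q, W ω = Function.update (Z ω) s v) →
      Q ∩ W ⁻¹' C = Q ∩ Z ⁻¹' ((fun z => Function.update z s v) ⁻¹' C) := by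
    intro W Q v hW
    ext ω
    simp only [Set.mem_inter_iff, Set.mem_preimage]
    exact and_congr_right fun hω => by rw [hW ω hω]
  rw [dec (Y ⁻¹' C), dec (Y' ⁻¹' C), pre hYA, pre hYA', pre hYB, pre hYB', hm _ (hup 0 hC),
    hm _ (hup 1 hC), add_comm (m (B ∩ Z ⁻¹' ((fun z => Function.update z s 0) ⁻¹' C)))]
  congr 2
  ext ω
  simp only [Set.mem_sdiff, Set.mem_preimage]
  constructor
  · rintro ⟨⟨h1, h2⟩, h3⟩
    exact ⟨⟨off ω h2 h3 ▸ h1, h2⟩, h3⟩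
  · rintro ⟨⟨h1, h2⟩, h3⟩
    exact ⟨⟨(off ω h2 h3).symm ▸ h1, h2⟩, h3⟩

end General

section Coordinates

variable {G R : Type*} {a : G} {k : ℕ} {A T : Set R}

lemma siteThin_eq_zero_iff {ω : G → Fin 2 × R} {g : G} :
    siteThin A ω g = 0 ↔ ω g ∈ {e : Fin 2 × R | e.1 = 1 ∧ e.2 ∈ A}ᶜ := by
  simp [siteThin]

lemma isKept_iff [Group G] {ω : G → Fin 2 × R} {h : G} {β : Bool} : IsKept a k A ω h β ↔
    ω (h * a ^ src k β) ∈ {e : Fin 2 × R | e.1 = 1 ∧ e.2 ∈ A} ∧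
      ω (h * a ^ src k (!β)) ∈ {e : Fin 2 × R | e.1 = 0} ∧
      ∀ i ∈ Finset.Icc (k + 6) (2 * k + 5), ω (h * a ^ i) ∈ {e : Fin 2 × R | e.1 = 0} :=
  Iff.rfl

/-- Written as a difference of two nested cylinders, whose probabilities are products. -/
lemma isRemoved_iff [Group G] {ω : G → Fin 2 × R} {h : G} {β : Bool} : IsRemoved a k A T ω h β ↔
    (ω (h * a ^ src k β) ∈ {e : Fin 2 × R | e.1 = 1 ∧ e.2 ∈ Aᶜ} ∧
      ω (h * a ^ src k (!β)) ∈ {e : Fin 2 × R | e.1 = 0 ∧ e.2 ∈ T} ∧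
      ∀ i ∈ Finset.Icc (k + 6) (2 * k + 5),
        ω (h * a ^ i) ∈ {e : Fin 2 × R | e.1 = 1 ∧ e.2 ∈ A}ᶜ) ∧
    ¬ (ω (h * a ^ src k β) ∈ {e : Fin 2 × R | e.1 = 1 ∧ e.2 ∈ Aᶜ} ∧
      ω (h * a ^ src k (!β)) ∈ {e : Fin 2 × R | e.1 = 0 ∧ e.2 ∈ T} ∧
      ∀ i ∈ Finset.Icc (k + 6) (2 * k + 5), ω (h * a ^ i) ∈ {e : Fin 2 × R | e.1 = 0}) := by
  simp only [IsRemoved, siteThin_eq_zero_iff]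
  simp only [Set.mem_ofPred_eq, Set.mem_compl_iff]
  tauto

variable [MeasurableSpace R]

lemma measurableSet_coord {ι E : Type*} [MeasurableSpace E] (i : ι) {V : Set E}
    (hV : MeasurableSet V) : MeasurableSet {ω : ι → E | ω i ∈ V} :=
  measurable_pi_apply i hV

lemma measurableSet_fst_eq (v : Fin 2) : MeasurableSet {e : Fin 2 × R | e.1 = v} :=
  measurable_fst (measurableSet_singleton v)

lemma measurableSet_kept (hA : MeasurableSet A) :
    MeasurableSet {e : Fin 2 × R | e.1 = 1 ∧ e.2 ∈ A} :=
  (measurableSet_fst_eq 1).inter (measurable_snd hA)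

lemma measurable_siteThin (hA : MeasurableSet A) :
    Measurable (siteThin A : (G → Fin 2 × R) → G → Fin 2) := by
  classical
  refine measurable_pi_iff.2 fun g => ?_
  exact Measurable.ite (measurableSet_coord g (measurableSet_kept hA)) measurable_const
    measurable_const

end Coordinates

/-! ### The corrected thinning has the law of sitewise thinning -/

section ThinLaw

variable {G R : Type*} [Group G] [MeasurableSpace R] {a : G} {k : ℕ} {A T : Set R}

lemma measurableSet_isMarked (h : G) : MeasurableSet {x : G → Fin 2 | IsMarked a k x h} := by
  have key : ∀ (i : ℕ) (v : Fin 2), MeasurableSet {x : G → Fin 2 | x (h * a ^ i) = v} := fun i v =>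
    measurableSet_eq_fun (measurable_pi_apply _) measurable_const
  simp only [IsMarked, Set.ofPred_and, Set.ofPred_forall]
  exact (MeasurableSet.iInter fun i => MeasurableSet.iInter fun _ => key i 1).inter
    ((key _ 0).inter (key _ 0))

lemma measurableSet_isSwitch (h : G) : MeasurableSet {x : G → Fin 2 | IsSwitch a k x h} := by
  have key : ∀ (i : ℕ) (v : Fin 2), MeasurableSet {x : G → Fin 2 | x (h * a ^ i) = v} := fun i v =>
    measurableSet_eq_fun (measurable_pi_apply _) measurable_const
  simp only [IsSwitch, Set.ofPred_and, Set.ofPred_forall]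
  exact (measurableSet_isMarked h).inter
    ((measurableSet_eq_fun (measurable_pi_apply (h * a ^ src k false))
      (measurable_pi_apply (h * a ^ src k true))).compl.inter
      (MeasurableSet.iInter fun i => MeasurableSet.iInter fun _ => key i 0))

lemma measurableSet_line (m₀ : MeasurableSpace (G → Fin 2 × R)) (h : G) {i j : ℕ} {K : Finset ℕ}
    (hm : ∀ l, l = i ∨ l = j ∨ l ∈ K → Measurable[m₀] fun ω : G → Fin 2 × R => ω (h * a ^ l))
    {U V W : Set (Fin 2 × R)} (hU : MeasurableSet U) (hV : MeasurableSet V)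
    (hW : MeasurableSet W) :
    MeasurableSet[m₀] {ω : G → Fin 2 × R |
      ω (h * a ^ i) ∈ U ∧ ω (h * a ^ j) ∈ V ∧ ∀ l ∈ K, ω (h * a ^ l) ∈ W} := by
  simp only [Set.ofPred_and, Set.ofPred_forall]
  refine MeasurableSet.inter (hm i (by simp) hU) (MeasurableSet.inter (hm j (by simp) hV) ?_)
  exact MeasurableSet.iInter fun l => MeasurableSet.iInter fun hl => hm l (by simp [hl]) hW

/-- The `σ`-algebra is left free so that it can be the one generated by the filler, as independence
requires. -/
lemma measurableSet_isKept (m₀ : MeasurableSpace (G → Fin 2 × R)) (hA : MeasurableSet A) (h : G)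
    (hm : ∀ l, k + 4 ≤ l → l ≤ 2 * k + 5 → Measurable[m₀] fun ω : G → Fin 2 × R => ω (h * a ^ l))
    (β : Bool) : MeasurableSet[m₀] {ω : G → Fin 2 × R | IsKept a k A ω h β} := by
  simp only [isKept_iff]
  refine measurableSet_line m₀ h (fun l hl => ?_) (measurableSet_kept hA) (measurableSet_fst_eq 0)
    (measurableSet_fst_eq 0)
  have h0 := src_mem k β
  have h1 := src_mem k (!β)
  rw [Finset.mem_Icc] at hl
  exact hm l (by omega) (by omega)

lemma measurableSet_isRemoved (m₀ : MeasurableSpace (G → Fin 2 × R)) (hA : MeasurableSet A)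
    (hT : MeasurableSet T) (h : G)
    (hm : ∀ l, k + 4 ≤ l → l ≤ 2 * k + 5 → Measurable[m₀] fun ω : G → Fin 2 × R => ω (h * a ^ l))
    (β : Bool) : MeasurableSet[m₀] {ω : G → Fin 2 × R | IsRemoved a k A T ω h β} := by
  simp only [isRemoved_iff]
  have hm' : ∀ l, l = src k β ∨ l = src k (!β) ∨ l ∈ Finset.Icc (k + 6) (2 * k + 5) →
      Measurable[m₀] fun ω : G → Fin 2 × R => ω (h * a ^ l) := by
    intro l hl
    have h0 := src_mem k β
    have h1 := src_mem k (!β)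
    rw [Finset.mem_Icc] at hl
    exact hm l (by omega) (by omega)
  have h1 := (measurableSet_fst_eq (R := R) 1).inter (measurable_snd hA.compl)
  have h2 := (measurableSet_fst_eq (R := R) 0).inter (measurable_snd hT)
  exact (measurableSet_line m₀ h hm' h1 h2 (measurableSet_kept hA).compl).inter
    (measurableSet_line m₀ h hm' h1 h2 (measurableSet_fst_eq 0)).compl

lemma measurableSet_isToggle (hA : MeasurableSet A) (hT : MeasurableSet T) (h : G) (β : Bool) :
    MeasurableSet {ω : G → Fin 2 × R | IsToggle a k A T ω h β} := by
  have hx : Measurable fun (ω : G → Fin 2 × R) g => (ω g).1 := by fun_prop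
  exact (hx (measurableSet_isMarked h)).inter
    ((measurableSet_isKept _ hA h (fun _ _ _ => measurable_pi_apply _) β).union
      (measurableSet_isRemoved _ hA hT h (fun _ _ _ => measurable_pi_apply _) β))

lemma measurable_thin (hA : MeasurableSet A) (hT : MeasurableSet T) (D : Set (G × Bool)) :
    Measurable (thin a k A T D) := by
  classical
  refine measurable_pi_iff.2 fun g => ?_
  refine Measurable.add (M := Fin 2) ((measurable_pi_apply g).comp (measurable_siteThin hA)) ?_
  refine Finset.measurable_sum (M := Fin 2) _ fun β _ => ?_
  refine Measurable.ite ?_ measurable_const measurable_const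
  exact (MeasurableSet.const _).inter (measurableSet_isToggle hA hT _ β)

lemma infinitePi_line {E : Type*} [MeasurableSpace E] (ν : Measure E) [IsProbabilityMeasure ν]
    (ha : Function.Injective (fun i : ℕ => a ^ i)) (h : G) {i j : ℕ} {K : Finset ℕ} (hij : i ≠ j)
    (hi : i ∉ K) (hj : j ∉ K) {U V W : Set E} (hU : MeasurableSet U)
    (hV : MeasurableSet V) (hW : MeasurableSet W) :
    Measure.infinitePi (fun _ : G => ν) {ω | ω (h * a ^ i) ∈ U ∧ ω (h * a ^ j) ∈ V ∧
      ∀ l ∈ K, ω (h * a ^ l) ∈ W} = ν U * (ν V * ν W ^ K.card) := by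
  have inj : Function.Injective fun l : ℕ => h * a ^ l := fun l l' e => ha (mul_left_cancel e)
  have hlaw := Measure.map_infinitePi_infinitePi_of_inj (P := fun _ : G => ν) inj
  let t : ℕ → Set E := fun l => if l = i then U else if l = j then V else W
  have ht : ∀ l, MeasurableSet (t l) := by
    intro l
    simp only [t]
    split_ifs <;> assumption
  have hti : ∀ l ∈ K, t l = W := by
    intro l hl
    have h1 : l ≠ i := fun e => hi (e ▸ hl)
    have h2 : l ≠ j := fun e => hj (e ▸ hl)
    simp [t, h1, h2]
  have hset : {ω : G → E | ω (h * a ^ i) ∈ U ∧ ω (h * a ^ j) ∈ V ∧ ∀ l ∈ K, ω (h * a ^ l) ∈ W} =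
      (fun ω (l : ℕ) => ω (h * a ^ l)) ⁻¹'
        Set.pi ((insert i (insert j K) : Finset ℕ) : Set ℕ) t := by
    ext ω
    simp only [Set.mem_ofPred_eq, Set.mem_preimage, Set.mem_pi, Finset.coe_insert,
      Set.forall_mem_insert, Finset.mem_coe]
    refine and_congr (by simp [t]) (and_congr (by simp [t, hij.symm]) ?_)
    exact forall₂_congr fun l hl => by rw [hti l hl]
  rw [hset, ← Measure.map_apply (by fun_prop)
    (MeasurableSet.pi (Finset.countable_toSet _) fun l _ => ht l), hlaw,
    Measure.infinitePi_pi _ (fun l _ => ht l),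
    Finset.prod_insert (by simp [hij, hi]), Finset.prod_insert hj,
    Finset.prod_congr rfl (fun l hl => by rw [hti l hl])]
  simp [t, hij.symm]

/-- `H` is the balance equation that determines `ρ T`. The label of the zero is not used by sitewise
thinning, so it is free to adjust the probability of `IsRemoved`. -/
lemma measure_isKept_eq_isRemoved (κ : Measure (Fin 2)) [IsProbabilityMeasure κ] (ρ : Measure R)
    [IsProbabilityMeasure ρ] (ha : Function.Injective (fun i : ℕ => a ^ i))
    (hA : MeasurableSet A) (hT : MeasurableSet T)
    (H : κ {1} * ρ A * (κ {0} * κ {0} ^ k) = κ {1} * ρ Aᶜ * (κ {0} * ρ T *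
      ((1 - κ {1} * ρ A) ^ k - κ {0} ^ k))) (h : G) (β : Bool) :
    Measure.infinitePi (fun _ : G => κ.prod ρ) {ω | IsKept a k A ω h β} =
      Measure.infinitePi (fun _ : G => κ.prod ρ) {ω | IsRemoved a k A T ω h β} := by
  have hne : src k β ≠ src k (!β) := fun e => by simpa using src_injective k e
  have hn : ∀ β, src k β ∉ Finset.Icc (k + 6) (2 * k + 5) := by
    intro β hβ
    have := src_mem k β
    rw [Finset.mem_Icc] at hβ
    omega
  have hcard : (Finset.Icc (k + 6) (2 * k + 5)).card = k := by
    rw [Nat.card_Icc]; omega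
  have m1 : ∀ (v : Fin 2) (B : Set R), κ.prod ρ {e | e.1 = v ∧ e.2 ∈ B} = κ {v} * ρ B := by
    intro v B
    rw [← Measure.prod_prod]
    congr 1
  have m2 : ∀ v : Fin 2, κ.prod ρ {e | e.1 = v} = κ {v} := by
    intro v
    simpa using m1 v Set.univ
  have m3 : κ.prod ρ {e | e.1 = 1 ∧ e.2 ∈ A}ᶜ = 1 - κ {1} * ρ A := by
    rw [prob_compl_eq_one_sub (measurableSet_kept hA), m1]
  have h1 : MeasurableSet {e : Fin 2 × R | e.1 = 1 ∧ e.2 ∈ Aᶜ} :=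
    (measurableSet_fst_eq (R := R) 1).inter (measurable_snd hA.compl)
  have h2 : MeasurableSet {e : Fin 2 × R | e.1 = 0 ∧ e.2 ∈ T} :=
    (measurableSet_fst_eq (R := R) 0).inter (measurable_snd hT)
  simp only [isKept_iff, isRemoved_iff]
  rw [infinitePi_line _ ha h hne (hn _) (hn _) (measurableSet_kept hA) (measurableSet_fst_eq 0)
    (measurableSet_fst_eq 0), hcard, m1, m2, H]
  change _ = Measure.infinitePi (fun _ : G => κ.prod ρ) ({ω | _} \ {ω | _})
  rw [measure_sdiff, infinitePi_line _ ha h hne (hn _) (hn _) h1 h2 (measurableSet_kept hA).compl,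
    infinitePi_line _ ha h hne (hn _) (hn _) h1 h2 (measurableSet_fst_eq 0), hcard, m2, m3]
  · rw [m1, m1, ← ENNReal.mul_sub, ← ENNReal.mul_sub]
    · intro _ _; finiteness
    · intro _ _; finiteness
  · rintro ω ⟨e1, e2, e3⟩
    refine ⟨e1, e2, fun i hi => ?_⟩
    have := e3 i hi
    simp only [Set.mem_ofPred_eq, Set.mem_compl_iff] at this ⊢
    rw [this]
    simp
  · exact (measurableSet_line _ h (fun _ _ => measurable_pi_apply _) h1 h2
      (measurableSet_fst_eq 0)).nullMeasurableSet
  · exact measure_ne_top _ _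

variable [Inhabited R]

/-- The state of the filler of a marked `h` is independent of the data outside of it. -/
lemma measure_inter_eraseFiller (ν : Measure (Fin 2 × R)) [IsProbabilityMeasure ν] (h : G)
    {Q : Set (G → Fin 2 × R)}
    (hQ : MeasurableSet[⨆ g ∈ filler a k h, MeasurableSpace.comap
      (fun ω : G → Fin 2 × R => ω g) inferInstance] Q)
    {C : Set (G → Fin 2 × R)} (hC : MeasurableSet C) :
    Measure.infinitePi (fun _ : G => ν) (Q ∩ eraseFiller a k h ⁻¹' C) =
      Measure.infinitePi (fun _ : G => ν) Q *
        Measure.infinitePi (fun _ : G => ν) (eraseFiller a k h ⁻¹' C) := by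
  refine (ProbabilityTheory.Indep_iff _ _ _).1
    (indep_iSup_comap_eval_infinitePi (fun _ : G => ν) (filler a k h)) _ _ hQ ?_
  have : Measurable[⨆ g ∈ (filler a k h)ᶜ, MeasurableSpace.comap
      (fun ω : G → Fin 2 × R => ω g) inferInstance] (eraseFiller (R := R) a k h) := by
    refine @measurable_pi_lambda _ _ _ (_) _ _ fun g => ?_
    by_cases hg : g ∈ filler a k h
    · simp only [eraseFiller, if_pos hg]
      exact measurable_const
    · simp only [eraseFiller, if_neg hg]
      exact (comap_measurable _).mono (le_iSup₂_of_le g hg le_rfl) le_rfl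
  exact this hC

/-- At a marked `h` the two states produce the same output off the site `h * a ^ src k β`, and
reversing the decision exchanges their values there. They have equal probability and are independent
of the erased data, which also determine whether `h` is marked. -/
lemma map_thin_insert (ν : Measure (Fin 2 × R)) [IsProbabilityMeasure ν]
    (ha : Function.Injective (fun i : ℕ => a ^ i)) (hA : MeasurableSet A) (hT : MeasurableSet T)
    (h : G) (β : Bool)
    (hν : Measure.infinitePi (fun _ : G => ν) {ω | IsKept a k A ω h β} =
      Measure.infinitePi (fun _ : G => ν) {ω | IsRemoved a k A T ω h β})
    {D : Set (G × Bool)} (hD : (h, β) ∉ D) :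
    (Measure.infinitePi (fun _ : G => ν)).map (thin a k A T (insert (h, β) D)) =
      (Measure.infinitePi (fun _ : G => ν)).map (thin a k A T D) := by
  classical
  set M : Set (G → Fin 2 × R) := {ω | IsMarked a k (fun g => (ω g).1) h} with hM
  have hx : Measurable fun (ω : G → Fin 2 × R) g => (ω g).1 := by fun_prop
  have hMm : MeasurableSet M := hx (measurableSet_isMarked h)
  have hMe : M = eraseFiller a k h ⁻¹' M := by
    ext ω
    exact (isMarked_eraseFiller_self ha).symm
  have hloc : ∀ l, k + 4 ≤ l → l ≤ 2 * k + 5 → Measurable[⨆ g ∈ filler a k h,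
      MeasurableSpace.comap (fun ω : G → Fin 2 × R => ω g) inferInstance]
        fun ω : G → Fin 2 × R => ω (h * a ^ l) := by
    intro l h1 h2
    exact (comap_measurable _).mono (le_iSup₂_of_le (h * a ^ l) ⟨l, h1, h2, rfl⟩ le_rfl) le_rfl
  have hK := measurableSet_isKept (a := a) (k := k) _ hA h (fun _ _ _ => measurable_pi_apply _) β
  have hRm := measurableSet_isRemoved (a := a) (k := k) _ hA hT h
    (fun _ _ _ => measurable_pi_apply _) β
  have hK0 : ∀ ω ∈ {ω | IsKept a k A ω h β} ∩ M, IsToggle a k A T ω h β ∧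
      siteThin A ω (h * a ^ src k β) = 1 := by
    rintro ω ⟨h1, h2⟩
    exact ⟨⟨h2, Or.inl h1⟩, if_pos h1.1⟩
  have hR0 : ∀ ω ∈ {ω | IsRemoved a k A T ω h β} ∩ M, IsToggle a k A T ω h β ∧
      siteThin A ω (h * a ^ src k β) = 0 := by
    rintro ω ⟨h1, h2⟩
    exact ⟨⟨h2, Or.inr h1⟩, if_neg fun h3 => h1.1.2 h3.2⟩
  have hDi : ∀ p, p ≠ (h, β) → (p ∈ insert (h, β) D ↔ p ∈ D) := by
    intro p hp
    simp [hp]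
  refine map_eq_map_of_interchange (Z := fun ω => thin a k A T D (eraseFiller a k h ω))
    (measurable_thin hA hT _) (measurable_thin hA hT _) (A := {ω | IsKept a k A ω h β} ∩ M)
    (B := {ω | IsRemoved a k A T ω h β} ∩ M) (hK.inter hMm) (hRm.inter hMm) ?_ ?_
    (h * a ^ src k β) ?_ ?_ ?_ ?_ ?_
  · rw [Set.disjoint_left]
    rintro ω ⟨h1, -⟩ ⟨h2, -⟩
    exact h2.1.2 h1.1.2
  · intro ω h1 h2
    apply thin_insert_of_not_isToggle
    rintro ⟨h3, h4 | h4⟩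
    · exact h1 ⟨h4, h3⟩
    · exact h2 ⟨h4, h3⟩
  · intro ω hω
    obtain ⟨ht, hs⟩ := hK0 ω hω
    refine thin_eq_update ha D (fun _ _ => Iff.rfl) ht ?_
    rw [thin_src_of_isToggle ha ht, hs, if_neg hD, add_zero]
  · intro ω hω
    obtain ⟨ht, hs⟩ := hK0 ω hω
    refine thin_eq_update ha _ hDi ht ?_
    rw [thin_src_of_isToggle ha ht, hs, if_pos (Set.mem_insert _ _)]
    rfl
  · intro ω hω
    obtain ⟨ht, hs⟩ := hR0 ω hω
    refine thin_eq_update ha D (fun _ _ => Iff.rfl) ht ?_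
    rw [thin_src_of_isToggle ha ht, hs, if_neg hD, add_zero]
  · intro ω hω
    obtain ⟨ht, hs⟩ := hR0 ω hω
    refine thin_eq_update ha _ hDi ht ?_
    rw [thin_src_of_isToggle ha ht, hs, if_pos (Set.mem_insert _ _)]
    rfl
  · intro C hC
    have e : M ∩ (fun ω => thin a k A T D (eraseFiller a k h ω)) ⁻¹' C =
        eraseFiller a k h ⁻¹' (M ∩ thin a k A T D ⁻¹' C) := by
      rw [Set.preimage_inter, ← hMe]
      rfl
    have hC' : MeasurableSet (M ∩ thin a k A T D ⁻¹' C) := hMm.inter (measurable_thin hA hT D hC)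
    rw [Set.inter_assoc, Set.inter_assoc, e,
      measure_inter_eraseFiller ν h (measurableSet_isKept _ hA h hloc β) hC',
      measure_inter_eraseFiller ν h (measurableSet_isRemoved _ hA hT h hloc β) hC', hν]

/-- Two random configurations have the same law if they agree in law up to modifications away from
any given finite set of coordinates. -/
lemma map_eq_of_finset_approx {Ω ι E : Type*} [MeasurableSpace Ω] [MeasurableSpace E]
    {m : Measure Ω} {ν : ι → Measure E} [∀ i, IsProbabilityMeasure (ν i)] {Y : Ω → ι → E}
    (hY : Measurable Y)
    (H : ∀ s : Finset ι, ∃ Y' : Ω → ι → E, Measurable Y' ∧ m.map Y' = Measure.infinitePi ν ∧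
      ∀ ω, ∀ i ∈ s, Y' ω i = Y ω i) :
    m.map Y = Measure.infinitePi ν := by
  refine Measure.eq_infinitePi _ fun s t ht => ?_
  obtain ⟨Y', hY', hlaw, heq⟩ := H s
  have hst : MeasurableSet (Set.pi (s : Set ι) t) :=
    MeasurableSet.pi s.countable_toSet fun i _ => ht i
  rw [← Measure.infinitePi_pi ν (fun i _ => ht i), ← hlaw, Measure.map_apply hY hst,
    Measure.map_apply hY' hst]
  congr 1
  ext ω
  simp only [Set.mem_preimage, Set.mem_pi, Finset.mem_coe]
  exact forall₂_congr fun i hi => by rw [heq ω i hi]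

lemma map_thin_univ (ν : Measure (Fin 2 × R)) [IsProbabilityMeasure ν]
    (ha : Function.Injective (fun i : ℕ => a ^ i)) (hA : MeasurableSet A) (hT : MeasurableSet T)
    (hν : ∀ h β, Measure.infinitePi (fun _ : G => ν) {ω | IsKept a k A ω h β} =
      Measure.infinitePi (fun _ : G => ν) {ω | IsRemoved a k A T ω h β})
    {ι : Measure (Fin 2)} [IsProbabilityMeasure ι]
    (hι : ν.map (fun e => siteThin A (fun _ : Unit => e) ()) = ι) :
    (Measure.infinitePi (fun _ : G => ν)).map (thin a k A T Set.univ) =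
      Measure.infinitePi (fun _ : G => ι) := by
  classical
  have base : (Measure.infinitePi (fun _ : G => ν)).map (siteThin A) =
      Measure.infinitePi (fun _ : G => ι) := by
    subst hι
    refine Measure.infinitePi_map_pi _
      (f := fun _ e => siteThin A (fun _ : Unit => e) ()) fun _ => ?_
    exact Measurable.ite (measurableSet_kept hA) measurable_const measurable_const
  have fin : ∀ D : Finset (G × Bool), (Measure.infinitePi (fun _ : G => ν)).map
      (thin a k A T D) = Measure.infinitePi (fun _ : G => ι) := by
    intro D
    induction D using Finset.induction_on with
    | empty => simpa [funext fun ω => thin_empty (a := a) (k := k) (A := A) (T := T) (ω := ω)]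
        using base
    | insert p D hp ih =>
      rw [Finset.coe_insert, ← ih]
      exact map_thin_insert ν ha hA hT p.1 p.2 (hν _ _) (by simpa using hp)
  -- Each site is affected by only two possible toggles, so finitely many of them settle any finite
  -- set of sites.
  refine map_eq_of_finset_approx (measurable_thin hA hT _) fun s => ?_
  refine ⟨_, measurable_thin hA hT _, fin (Finset.image (fun p : G × Bool =>
    (p.1 * (a ^ src k p.2)⁻¹, p.2)) (s ×ˢ Finset.univ)), fun ω g hg => ?_⟩
  unfold thin
  congr 1
  refine Finset.sum_congr rfl fun β _ => ?_
  congr 1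
  rw [eq_iff_iff]
  refine and_congr_left fun _ => ?_
  simp only [Finset.coe_image, Set.mem_univ, iff_true]
  exact ⟨(g, β), by simp [hg], rfl⟩

end ThinLaw

/-! ### Coin flips preserve the Bernoulli measure -/

section CoinFlipLaw

variable {G : Type*} [Group G] {a : G} {k : ℕ}

lemma measurable_coinFlip :
    Measurable fun p : (G → Fin 2) × (G → Fin 2) => coinFlip a k p.1 p.2 := by
  classical
  refine measurable_pi_iff.2 fun g => ?_
  refine Measurable.add (M := Fin 2) (by fun_prop) ?_
  refine Finset.measurable_sum (M := Fin 2) _ fun β _ => ?_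
  exact Measurable.ite (measurable_fst (measurableSet_isSwitch _)) (by fun_prop) measurable_const

lemma measurable_coinFlip_left (c : G → Fin 2) :
    Measurable fun x : G → Fin 2 => coinFlip a k x c :=
  measurable_coinFlip.comp (measurable_id.prodMk measurable_const)

/-- On the event that `h` is a switch the flip is a transposition of coordinates, which preserves
both this event and the product measure; off it the flip is the identity. -/
lemma map_coinFlip_single [DecidableEq G] (κ : Measure (Fin 2)) [IsProbabilityMeasure κ]
    (ha : Function.Injective (fun i : ℕ => a ^ i)) (h : G) (v : Fin 2) :
    (Measure.infinitePi fun _ : G => κ).map (fun x => coinFlip a k x (Pi.single h v)) =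
      Measure.infinitePi fun _ : G => κ := by
  have two : v = 0 ∨ v = 1 := by
    have : ∀ v : Fin 2, v = 0 ∨ v = 1 := by decide
    exact this v
  rcases two with rfl | rfl
  · simp only [Pi.single_zero, coinFlip_zero, Measure.map_id']
  let W : Set (G → Fin 2) := {x | IsSwitch a k x h}
  have hW : MeasurableSet W := measurableSet_isSwitch h
  have hf : Measurable fun x : G → Fin 2 => coinFlip a k x (Pi.single h 1) :=
    measurable_coinFlip_left _
  obtain ⟨σ, hσσ, hflip⟩ : ∃ σ : Equiv.Perm G, σ.trans σ = Equiv.refl G ∧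
      ∀ x ∈ W, coinFlip a k x (Pi.single h 1) = x ∘ σ :=
    ⟨_, Equiv.swap_swap _ _, fun x hx => coinFlip_single ha h hx⟩
  have hσ : Measurable fun (x : G → Fin 2) g => x (σ g) :=
    measurable_pi_lambda _ fun g => measurable_pi_apply _
  have hlaw : (Measure.infinitePi fun _ : G => κ).map (fun x g => x (σ g)) =
      Measure.infinitePi fun _ : G => κ :=
    Measure.map_infinitePi_infinitePi_of_inj (P := fun _ : G => κ) σ.injective
  have hWσ : ∀ x : G → Fin 2, (x ∘ σ) ∈ W ↔ x ∈ W := by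
    have mp : ∀ x : G → Fin 2, x ∈ W → (x ∘ σ) ∈ W := by
      intro x hx
      have := (isSwitch_coinFlip ha (Pi.single h 1)).2 hx
      rwa [hflip x hx] at this
    refine fun x => ⟨fun hx => ?_, mp x⟩
    have := mp _ hx
    rwa [Function.comp_assoc, ← Equiv.coe_trans, hσσ, Equiv.coe_refl,
      Function.comp_id] at this
  ext C hC
  rw [Measure.map_apply hf hC, ← measure_inter_add_sdiff _ hW, ← measure_inter_add_sdiff C hW]
  congr 1
  · have e : (fun x => coinFlip a k x (Pi.single h 1)) ⁻¹' C ∩ W =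
        (fun (x : G → Fin 2) g => x (σ g)) ⁻¹' (C ∩ W) := by
      ext x
      simp only [Set.mem_inter_iff, Set.mem_preimage]
      have h1 := hWσ x
      constructor
      · rintro ⟨h2, h3⟩
        rw [hflip x h3] at h2
        exact ⟨h2, h1.2 h3⟩
      · rintro ⟨h2, h3⟩
        refine ⟨?_, h1.1 h3⟩
        rw [hflip x (h1.1 h3)]
        exact h2
    rw [e, ← Measure.map_apply hσ (hC.inter hW), hlaw]
  · congr 1
    ext x
    simp only [Set.mem_sdiff, Set.mem_preimage]
    exact and_congr_left fun hx => by rw [coinFlip_single_of_not h hx]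

lemma map_coinFlip (κ : Measure (Fin 2)) [IsProbabilityMeasure κ]
    (ha : Function.Injective (fun i : ℕ => a ^ i)) (c : G → Fin 2) :
    (Measure.infinitePi fun _ : G => κ).map (fun x => coinFlip a k x c) =
      Measure.infinitePi fun _ : G => κ := by
  classical
  have hm : ∀ c : G → Fin 2, Measurable fun x : G → Fin 2 => coinFlip a k x c :=
    measurable_coinFlip_left
  have fin : ∀ D : Finset G, ∀ c : G → Fin 2, (∀ h ∉ D, c h = 0) →
      (Measure.infinitePi fun _ : G => κ).map (fun x => coinFlip a k x c) =
        Measure.infinitePi fun _ : G => κ := by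
    intro D
    induction D using Finset.induction_on with
    | empty =>
      intro c hc
      obtain rfl : c = 0 := funext fun h => hc h (by simp)
      simp only [coinFlip_zero, Measure.map_id']
    | insert h D hD ih =>
      intro c hc
      have e : c = Function.update c h 0 + Pi.single h (c h) := by
        ext1 g
        by_cases hg : g = h
        · subst hg; simp
        · simp [hg]
      have h1 := ih (Function.update c h 0) (by
        intro g hg
        by_cases hgh : g = h
        · subst hgh; simp
        · rw [Function.update_of_ne hgh]
          exact hc g (by simp [hg, hgh]))
      have h2 := map_coinFlip_single (k := k) κ ha h (c h)
      have : (fun x => coinFlip a k x c) = (fun x => coinFlip a k x (Pi.single h (c h))) ∘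
          fun x => coinFlip a k x (Function.update c h 0) := by
        ext1 x
        rw [Function.comp_apply, coinFlip_coinFlip ha, ← e]
      rw [this, ← Measure.map_map (hm _) (hm _), h1, h2]
  refine map_eq_of_finset_approx (hm c) fun s => ?_
  let D : Finset G := Finset.image (fun p : G × Bool => p.1 * (a ^ src k p.2)⁻¹) (s ×ˢ Finset.univ)
  refine ⟨_, hm (fun h => if h ∈ D then c h else 0), fin D _ (fun h hh => if_neg hh), ?_⟩
  intro x g hg
  unfold coinFlip
  congr 1
  refine Finset.sum_congr rfl fun β _ => ?_
  beta_reduce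
  rw [if_pos (show g * (a ^ src k β)⁻¹ ∈ D from
    Finset.mem_image.2 ⟨(g, β), by simp [hg], rfl⟩)]

/-- Flipping independent coins preserves the Bernoulli measure. -/
lemma map_coinFlip_prod (κ : Measure (Fin 2)) [IsProbabilityMeasure κ]
    (ha : Function.Injective (fun i : ℕ => a ^ i)) (θ : Measure (G → Fin 2))
    [IsProbabilityMeasure θ] :
    ((Measure.infinitePi fun _ : G => κ).prod θ).map (fun p => coinFlip a k p.1 p.2) =
      Measure.infinitePi fun _ : G => κ := by
  ext C hC
  rw [Measure.map_apply measurable_coinFlip hC,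
    Measure.prod_apply_symm (measurable_coinFlip hC)]
  have : ∀ c, (Measure.infinitePi fun _ : G => κ)
      ((fun x => (x, c)) ⁻¹' ((fun p : (G → Fin 2) × (G → Fin 2) => coinFlip a k p.1 p.2) ⁻¹' C)) =
      (Measure.infinitePi fun _ : G => κ) C := by
    intro c
    conv_rhs => rw [← map_coinFlip (k := k) κ ha c]
    rw [Measure.map_apply (measurable_coinFlip_left c) hC]
    rfl
  simp [this]

end CoinFlipLaw

/-! ### Product measures and almost sure occurrence of switches -/

section Zip

/-- Pairing two independent product measures coordinatewise. -/
lemma map_zip_infinitePi {ι E F : Type*} [MeasurableSpace E] [MeasurableSpace F]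
    (μ : Measure E) (ν : Measure F) [IsProbabilityMeasure μ] [IsProbabilityMeasure ν] :
    ((Measure.infinitePi fun _ : ι => μ).prod (Measure.infinitePi fun _ : ι => ν)).map
      (fun p i => (p.1 i, p.2 i)) = Measure.infinitePi fun _ : ι => μ.prod ν := by
  refine Measure.eq_infinitePi _ fun s t ht => ?_
  have hz : Measurable fun (p : (ι → E) × (ι → F)) i => (p.1 i, p.2 i) := by fun_prop
  have hst : MeasurableSet (Set.pi (s : Set ι) t) :=
    MeasurableSet.pi s.countable_toSet fun i _ => ht i
  rw [Measure.map_apply hz hst, Measure.prod_apply (hz hst)]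
  have h1 : ∀ x : ι → E, (Measure.infinitePi fun _ : ι => ν)
      (Prod.mk x ⁻¹' ((fun (p : (ι → E) × (ι → F)) i => (p.1 i, p.2 i)) ⁻¹' Set.pi (s : Set ι) t)) =
      ∏ i ∈ s, ν (Prod.mk (x i) ⁻¹' t i) := by
    intro x
    rw [← Measure.infinitePi_pi (fun _ : ι => ν) (fun i _ => measurable_prodMk_left (ht i))]
    rfl
  simp only [h1]
  have hind := ProbabilityTheory.iIndepFun_infinitePi (P := fun _ : ι => μ)
    (X := fun i (e : E) => ν (Prod.mk e ⁻¹' t i)) (fun i => measurable_measure_prodMk_left (ht i))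
  have := ProbabilityTheory.lintegral_prod_eq_prod_lintegral_of_indepFun s _ hind
    (fun i => (measurable_measure_prodMk_left (ht i)).comp (measurable_pi_apply i))
  rw [this]
  refine Finset.prod_congr rfl fun i _ => ?_
  rw [Measure.prod_apply (ht i)]
  conv_rhs => rw [← Measure.infinitePi_map_eval (fun _ : ι => μ) i]
  rw [lintegral_map (measurable_measure_prodMk_left (ht i)) (measurable_pi_apply i)]

end Zip

section Hit

/-- Disjoint translates of a pattern of positive probability occur almost surely. -/
lemma ae_exists_pattern {ι E : Type*} [MeasurableSpace E] [MeasurableSingletonClass E]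
    (ν : Measure E) [IsProbabilityMeasure ν] {L : ℕ} (f : ℕ × Fin L → ι)
    (hf : Function.Injective f) (w : Fin L → E) (hw : ∀ i, ν {w i} ≠ 0) :
    ∀ᵐ x ∂(Measure.infinitePi fun _ : ι => ν), ∃ j, ∀ i, x (f (j, i)) = w i := by
  set pat : Set (Fin L → E) := {w} with hpat
  have hlaw : (Measure.infinitePi fun _ : ι => ν).map (fun x j i => x (f (j, i))) =
      Measure.infinitePi fun _ : ℕ => Measure.infinitePi fun _ : Fin L => ν := by
    rw [← Measure.infinitePi_map_curry (fun _ : ℕ => fun _ : Fin L => ν),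
      ← Measure.map_infinitePi_infinitePi_of_inj (P := fun _ : ι => ν) hf, Measure.map_map]
    · rfl
    · fun_prop
    · fun_prop
  have hm : Measurable fun (x : ι → E) (j : ℕ) (i : Fin L) => x (f (j, i)) := by fun_prop
  have hpm : MeasurableSet pat := measurableSet_singleton w
  have hpos : (Measure.infinitePi fun _ : Fin L => ν) pat ≠ 0 := by
    rw [hpat, Measure.infinitePi_singleton_of_fintype, Finset.prod_ne_zero_iff]
    exact fun i _ => hw i
  set r := (Measure.infinitePi fun _ : Fin L => ν) patᶜ with hr
  have hr1 : r < 1 := by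
    rw [hr, prob_compl_eq_one_sub hpm]
    exact ENNReal.sub_lt_self ENNReal.one_ne_top one_ne_zero hpos
  have hbound : ∀ n : ℕ, (Measure.infinitePi fun _ : ι => ν)
      {x | ¬ ∃ j, ∀ i, x (f (j, i)) = w i} ≤ r ^ n := by
    intro n
    have h1 : (Measure.infinitePi fun _ : ℕ => Measure.infinitePi fun _ : Fin L => ν)
        (Set.pi (Finset.range n : Set ℕ) fun _ => patᶜ) = r ^ n := by
      rw [Measure.infinitePi_pi _ (fun _ _ => hpm.compl)]
      simp [hr]
    rw [← h1, ← hlaw, Measure.map_apply hm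
      (MeasurableSet.pi (Finset.countable_toSet _) fun _ _ => hpm.compl)]
    refine measure_mono fun x hx => ?_
    intro j _ hj
    exact hx ⟨j, fun i => congrFun hj i⟩
  rw [ae_iff]
  refine le_antisymm (ge_of_tendsto' (ENNReal.tendsto_pow_atTop_nhds_zero_of_lt_one hr1) hbound)
    (zero_le)

variable {G : Type*} [Group G] {a : G} {k : ℕ}

/-- The pattern of a switch. -/
def switchPattern (k : ℕ) (i : ℕ) : Fin 2 := if i ≤ k + 2 ∨ i = k + 4 then 1 else 0

lemma isSwitch_of_pattern {x : G → Fin 2} {h : G}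
    (H : ∀ i : Fin (2 * k + 7), x (h * a ^ (i : ℕ)) = switchPattern k i) : IsSwitch a k x h := by
  have H' : ∀ i, i < 2 * k + 7 → x (h * a ^ i) = switchPattern k i := fun i hi => H ⟨i, hi⟩
  refine ⟨⟨fun i hi => ?_, ?_, ?_⟩, ?_, fun i hi => ?_⟩
  · rw [H' i (by omega)]; simp [switchPattern, hi]
  · rw [H' _ (by omega)]; simp [switchPattern]
  · rw [H' _ (by omega), switchPattern, if_neg (by omega)]
  · rw [H' _ (by simp [src]; omega), H' _ (by simp [src]; omega)]; simp [switchPattern, src]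
  · rw [Finset.mem_Icc] at hi
    rw [H' _ (by omega), switchPattern, if_neg (by omega)]

lemma ae_exists_isSwitch (κ : Measure (Fin 2)) [IsProbabilityMeasure κ] (h0 : κ {0} ≠ 0)
    (h1 : κ {1} ≠ 0) (f : ℕ → G)
    (hf : Function.Injective fun p : ℕ × Fin (2 * k + 7) => f p.1 * a ^ (p.2 : ℕ)) :
    ∀ᵐ x ∂(Measure.infinitePi fun _ : G => κ), ∃ j, IsSwitch a k x (f j) := by
  have := ae_exists_pattern κ _ hf (fun i => switchPattern k i) (by
    intro i
    unfold switchPattern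
    split_ifs <;> assumption)
  filter_upwards [this] with x hx
  obtain ⟨j, hj⟩ := hx
  exact ⟨j, isSwitch_of_pattern hj⟩

end Hit

/-! ### Fair coins and sets of prescribed measure -/

section Bits

/-- The fair coin. -/
noncomputable def fairCoin : Measure (Fin 2) := ProbabilityTheory.uniformOn Set.univ

instance : IsProbabilityMeasure fairCoin := by unfold fairCoin; infer_instance

lemma fairCoin_singleton (v : Fin 2) : fairCoin {v} = 2⁻¹ := by
  rw [fairCoin, ProbabilityTheory.uniformOn_univ]
  simp

lemma map_add_fairCoin (v : Fin 2) : fairCoin.map (fun u => v + u) = fairCoin := by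
  refine Measure.ext_of_singleton fun w => ?_
  rw [Measure.map_apply (by fun_prop) (measurableSet_singleton w)]
  have : (fun u => v + u) ⁻¹' {w} = {-v + w} := by
    ext u
    simp [eq_neg_add_iff_add_eq]
  rw [this, fairCoin_singleton, fairCoin_singleton]

instance : NullSingletonClass (Measure.infinitePi fun _ : ℕ => fairCoin) := by
  refine ⟨fun x => ?_⟩
  have hb : ∀ n : ℕ, (Measure.infinitePi fun _ : ℕ => fairCoin) {x} ≤ (2⁻¹ : ENNReal) ^ n := by
    intro n
    calc _ ≤ (Measure.infinitePi fun _ : ℕ => fairCoin)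
          (Set.pi (Finset.range n : Set ℕ) fun i => {x i}) := measure_mono (by
            rintro _ rfl
            simp [Set.mem_pi])
      _ = _ := by
        rw [Measure.infinitePi_pi _ (fun _ _ => measurableSet_singleton _)]
        simp [fairCoin_singleton]
  exact le_antisymm (ge_of_tendsto'
    (ENNReal.tendsto_pow_atTop_nhds_zero_of_lt_one (by norm_num)) hb) zero_le

/-- An atomless probability measure on a standard Borel space takes all values in `[0, 1]`. -/
lemma exists_measurableSet_measureReal_eq {R : Type*} [MeasurableSpace R] [StandardBorelSpace R]
    (ρ : Measure R) [IsProbabilityMeasure ρ] [NullSingletonClass ρ] {r : ℝ} (h0 : 0 ≤ r)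
    (h1 : r ≤ 1) : ∃ A, MeasurableSet A ∧ ρ.real A = r := by
  rcases h0.eq_or_lt with rfl | h0
  · exact ⟨∅, .empty, by simp⟩
  rcases h1.eq_or_lt with rfl | h1
  · exact ⟨Set.univ, .univ, by simp⟩
  obtain ⟨f, hf⟩ := exists_measurableEmbedding_real R
  set ν := ρ.map f
  have : IsProbabilityMeasure ν := Measure.isProbabilityMeasure_map hf.measurable.aemeasurable
  have hatom : ∀ t, ν {t} = 0 := by
    intro t
    rw [Measure.map_apply hf.measurable (measurableSet_singleton t)]
    exact Set.Subsingleton.measure_zero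
      (fun u hu v hv => hf.injective (hu.trans hv.symm)) ρ
  -- Absence of atoms makes the distribution function continuous; the intermediate value theorem
  -- then gives a half-line of measure `r`.
  have hcont : Continuous (ProbabilityTheory.cdf ν) := by
    rw [continuous_iff_continuousAt]
    intro t
    rw [(ProbabilityTheory.cdf ν).mono.continuousAt_iff_leftLim_eq_rightLim,
      StieltjesFunction.rightLim_eq]
    have h2 := (ProbabilityTheory.cdf ν).measure_singleton t
    rw [ProbabilityTheory.measure_cdf, hatom, eq_comm, ENNReal.ofReal_eq_zero] at h2
    exact le_antisymm ((ProbabilityTheory.cdf ν).mono.leftLim_le le_rfl) (by linarith)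
  obtain ⟨t, ht⟩ := mem_range_of_exists_le_of_exists_ge hcont
    ((((ProbabilityTheory.tendsto_cdf_atBot ν).eventually (gt_mem_nhds h0)).exists).imp
      fun _ h => h.le)
    ((((ProbabilityTheory.tendsto_cdf_atTop ν).eventually (lt_mem_nhds h1)).exists).imp
      fun _ h => h.le)
  refine ⟨f ⁻¹' Set.Iic t, hf.measurable measurableSet_Iic, ?_⟩
  rw [← ht, ProbabilityTheory.cdf_eq_real, map_measureReal_apply hf.measurable measurableSet_Iic]

end Bits

/-! ### From one coin per switch to independent labels at all sites -/

section Seed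

variable {G : Type*} [Group G]

/-- The first point of `W` on the ray `g b, g b², …`. -/
noncomputable def nextHit (b : G) (W : Set G) (g : G) : G :=
  g * b ^ (sInf {i : ℕ | g * b ^ (i + 1) ∈ W} + 1)

/-- Iterate `n` times the operation that adds to every coin the next one in direction `b`. -/
noncomputable def coinLevel (b : G) (W : Set G) : ℕ → (G → Fin 2) → G → Fin 2
  | 0, c => c
  | n + 1, c => coinLevel b W n fun g => c g + c (nextHit b W g)

/-- The `n`-th bit that is obtained at `g` from the coins `c` placed on `W`. -/
noncomputable def coinBit (a b : G) (W : Set G) (c : G → Fin 2) (n : ℕ) (g : G) : Fin 2 :=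
  coinLevel b W n c g + coinLevel b W n c (nextHit a W g)

/-- The distance to the first point of `W` on the ray `g, g b, g b², …`. -/
noncomputable def hitTime (b : G) (W : Set G) (g : G) : ℕ := sInf {i : ℕ | g * b ^ i ∈ W}

/-- A sequence of bits for each `g`, obtained from the first point of `W` on the ray
`g, g b, g b², …` in such a way that distinct `g` use distinct bits. -/
noncomputable def seed (a b : G) (W : Set G) (c : G → Fin 2) (g : G) : ℕ → Fin 2 := fun j =>
  coinBit a b W c (Nat.pair (hitTime b W g) j) (g * b ^ hitTime b W g)

variable {a b : G} {W : Set G}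

lemma coinLevel_add (n : ℕ) (c c' : G → Fin 2) :
    coinLevel b W n (c + c') = coinLevel b W n c + coinLevel b W n c' := by
  induction n generalizing c c' with
  | zero => rfl
  | succ n ih =>
    simp only [coinLevel]
    rw [← ih]
    congr 1
    ext1 g
    simp only [Pi.add_apply]
    abel

lemma seed_add (c c' : G → Fin 2) (g : G) (j : ℕ) :
    seed a b W (c + c') g j = seed a b W c g j + seed a b W c' g j := by
  simp only [seed, coinBit, coinLevel_add, Pi.add_apply]
  abel

lemma coinLevel_congr {M : Set G} (hM : ∀ w ∈ M, nextHit b W w ∈ M) {c c' : G → Fin 2}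
    (e : ∀ w ∈ M, c w = c' w) (n : ℕ) : ∀ w ∈ M, coinLevel b W n c w = coinLevel b W n c' w := by
  induction n generalizing c c' with
  | zero => exact e
  | succ n ih => exact ih fun w hw => by rw [e w hw, e _ (hM w hw)]

lemma nextHit_mem {g : G} (h : ∃ i : ℕ, g * b ^ (i + 1) ∈ W) : nextHit b W g ∈ W :=
  Nat.sInf_mem (s := {i : ℕ | g * b ^ (i + 1) ∈ W}) h

lemma mul_pow_hitTime_mem {g : G} (h : ∃ i : ℕ, g * b ^ i ∈ W) : g * b ^ hitTime b W g ∈ W :=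
  Nat.sInf_mem (s := {i : ℕ | g * b ^ i ∈ W}) h

section Solve

variable {S : Type*}

/-- On the Cayley tree of a free group, every function on the edges is a coboundary. -/
lemma exists_forall_mul_of_eq (r : S → FreeGroup S → Fin 2) :
    ∃ C : FreeGroup S → Fin 2, ∀ σ g, C (g * FreeGroup.of σ) = C g + r σ g := by
  -- By freeness, generators may act by arbitrary skew translations of `FreeGroup S × Fin 2`; the
  -- orbit of `(1, 0)` integrates `r'`. The inverses in `r'` convert left multiplication into right
  -- multiplication.
  let r' : S → FreeGroup S → Fin 2 := fun σ f => - r σ (f⁻¹ * (FreeGroup.of σ)⁻¹)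
  let π : S → Equiv.Perm (FreeGroup S × Fin 2) := fun σ =>
    { toFun := fun p => (FreeGroup.of σ * p.1, p.2 + r' σ p.1)
      invFun := fun p => ((FreeGroup.of σ)⁻¹ * p.1, p.2 - r' σ ((FreeGroup.of σ)⁻¹ * p.1))
      left_inv := fun p => by simp
      right_inv := fun p => by simp }
  have hfst : ∀ (g : FreeGroup S) p, (FreeGroup.lift π g p).1 = g * p.1 := by
    intro g
    induction g using FreeGroup.induction_on with
    | C1 => simp
    | of σ => intro p; simp [π]
    | inv_of σ _ => intro p; simp [π, Equiv.Perm.inv_def]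
    | mul x y hx hy => intro p; rw [map_mul, Equiv.Perm.mul_apply, hx, hy, mul_assoc]
  let D : FreeGroup S → Fin 2 := fun g => (FreeGroup.lift π g (1, 0)).2
  have hD : ∀ σ g, D (FreeGroup.of σ * g) = D g + r' σ g := by
    intro σ g
    simp only [D, map_mul, Equiv.Perm.mul_apply, FreeGroup.lift_apply_of]
    simp [π, hfst]
  refine ⟨fun g => D g⁻¹, fun σ g => ?_⟩
  have := hD σ (g * FreeGroup.of σ)⁻¹
  simp only [r', inv_inv, mul_inv_cancel_right] at this
  beta_reduce
  rw [mul_inv_rev] at this ⊢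
  rw [mul_inv_cancel_left] at this
  rw [this]
  simp

/-- Prescribe the increments of `c` to be `p` and `q` on the `s₀`- and `s₁`-edges leaving `W`, and
zero on all other edges. On the way from `w` to its next hit only the first edge then contributes.
-/
lemma exists_coins_next {s₀ s₁ : S} (hs : s₀ ≠ s₁) (W : Set (FreeGroup S))
    (p q : FreeGroup S → Fin 2) : ∃ c : FreeGroup S → Fin 2, ∀ w ∈ W,
      ((∃ i : ℕ, w * FreeGroup.of s₀ ^ (i + 1) ∈ W) →
        c w + c (nextHit (FreeGroup.of s₀) W w) = p w) ∧
      ((∃ i : ℕ, w * FreeGroup.of s₁ ^ (i + 1) ∈ W) →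
        c w + c (nextHit (FreeGroup.of s₁) W w) = q w) := by
  classical
  let r : S → FreeGroup S → Fin 2 := fun σ g =>
    if g ∈ W then (if σ = s₀ then p g else if σ = s₁ then q g else 0) else 0
  obtain ⟨c, hc⟩ := exists_forall_mul_of_eq r
  have key : ∀ σ, ∀ w ∈ W, c w + c (nextHit (FreeGroup.of σ) W w) = r σ w := by
    intro σ w _
    have h1 : ∀ j ≤ sInf {i : ℕ | w * FreeGroup.of σ ^ (i + 1) ∈ W},
        c (w * FreeGroup.of σ ^ (j + 1)) = c w + r σ w := by
      intro j
      induction j with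
      | zero => intro _; rw [zero_add, pow_one, hc]
      | succ j ih =>
        intro hj
        have hn : w * FreeGroup.of σ ^ (j + 1) ∉ W := Nat.notMem_of_lt_sInf (Nat.lt_of_succ_le hj)
        rw [pow_succ, ← mul_assoc, hc, ih (Nat.le_of_succ_le hj)]
        simp [r, hn]
    rw [nextHit, h1 _ le_rfl, ← add_assoc]
    have : ∀ u v : Fin 2, u + u + v = v := by decide
    exact this _ _
  refine ⟨c, fun w hw => ⟨fun _ => ?_, fun _ => ?_⟩⟩
  · rw [key s₀ w hw]; simp [r, hw]
  · rw [key s₁ w hw]; simp [r, hw, hs.symm]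

/-- Solve backwards: coins `c'` that realise the later bits become the prescribed `s₁`-sums, and bit
zero the `s₀`-sums. -/
lemma exists_coins_coinBit {s₀ s₁ : S} (hs : s₀ ≠ s₁) {W M : Set (FreeGroup S)} (hMW : M ⊆ W)
    (h₀ : ∀ w ∈ M, ∃ i : ℕ, w * FreeGroup.of s₀ ^ (i + 1) ∈ W)
    (h₁ : ∀ w ∈ M, ∃ i : ℕ, w * FreeGroup.of s₁ ^ (i + 1) ∈ W)
    (hM₀ : ∀ w ∈ M, nextHit (FreeGroup.of s₀) W w ∈ M)
    (hM₁ : ∀ w ∈ M, nextHit (FreeGroup.of s₁) W w ∈ M) (n : ℕ)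
    (v : ℕ → FreeGroup S → Fin 2) : ∃ c : FreeGroup S → Fin 2, ∀ j < n, ∀ w ∈ M,
      coinBit (FreeGroup.of s₀) (FreeGroup.of s₁) W c j w = v j w := by
  induction n generalizing v with
  | zero => exact ⟨0, by simp⟩
  | succ n ih =>
    obtain ⟨c', hc'⟩ := ih fun j => v (j + 1)
    obtain ⟨c, hc⟩ := exists_coins_next hs W (v 0) c'
    refine ⟨c, fun j hj w hw => ?_⟩
    rcases j with _ | j
    · exact (hc w (hMW hw)).1 (h₀ w hw)
    · have e : ∀ w ∈ M, coinLevel (FreeGroup.of s₁) W (j + 1) c w =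
          coinLevel (FreeGroup.of s₁) W j c' w :=
        coinLevel_congr hM₁ (fun w hw => (hc w (hMW hw)).2 (h₁ w hw)) j
      rw [← hc' j (by omega) w hw, coinBit, coinBit, e w hw, e _ (hM₀ w hw)]

end Solve

section Measurability

variable {Ω : Type*} [MeasurableSpace Ω] {Wω : Ω → Set G}

lemma measurable_sInf_nat {P : Ω → Set ℕ} (hP : ∀ i, MeasurableSet {ω | i ∈ P ω}) :
    Measurable fun ω => sInf (P ω) := by
  refine measurable_to_countable' fun n => ?_
  have : (fun ω => sInf (P ω)) ⁻¹' {n} = ({ω | n ∈ P ω} ∩ ⋂ j, ⋂ _ : j < n, {ω | j ∈ P ω}ᶜ) ∪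
      ({_ω | n = 0} ∩ ⋂ j, {ω | j ∈ P ω}ᶜ) := by
    ext ω
    simp only [Set.mem_preimage, Set.mem_singleton_iff, Set.mem_union, Set.mem_inter_iff,
      Set.mem_iInter, Set.mem_compl_iff, Set.mem_ofPred_eq]
    constructor
    · rintro rfl
      rcases (P ω).eq_empty_or_nonempty with he | hne
      · right; simp [he]
      · left; exact ⟨Nat.sInf_mem hne, fun j hj => Nat.notMem_of_lt_sInf hj⟩
    · rintro (⟨h1, h2⟩ | ⟨rfl, h2⟩)
      · refine le_antisymm (Nat.sInf_le h1) ?_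
        by_contra hlt
        exact h2 _ (not_le.1 hlt) (Nat.sInf_mem ⟨n, h1⟩)
      · rw [Set.eq_empty_of_forall_notMem h2, Nat.sInf_empty]
  rw [this]
  exact ((hP n).inter (MeasurableSet.iInter fun j => MeasurableSet.iInter fun _ =>
    (hP j).compl)).union ((MeasurableSet.const _).inter (MeasurableSet.iInter fun j =>
      (hP j).compl))

lemma Measurable.eval_nat {E : Type*} [MeasurableSpace E] {f : Ω → ℕ} (hf : Measurable f)
    {F : ℕ → Ω → E} (hF : ∀ i, Measurable (F i)) : Measurable fun ω => F (f ω) ω := by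
  intro C hC
  have : (fun ω => F (f ω) ω) ⁻¹' C = ⋃ i, f ⁻¹' {i} ∩ F i ⁻¹' C := by
    ext ω
    simp
  rw [this]
  exact MeasurableSet.iUnion fun i => (hf (measurableSet_singleton i)).inter (hF i hC)

lemma measurable_comp_nextHit (hW : ∀ g, MeasurableSet {ω | g ∈ Wω ω})
    {F : Ω → G → Fin 2} (hF : ∀ g, Measurable fun ω => F ω g) (b g : G) :
    Measurable fun ω => F ω (nextHit b (Wω ω) g) :=
  Measurable.eval_nat (F := fun i ω => F ω (g * b ^ (i + 1)))
    (measurable_sInf_nat (P := fun ω => {i : ℕ | g * b ^ (i + 1) ∈ Wω ω}) fun _ => hW _)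
    fun _ => hF _

lemma measurable_coinLevel (hW : ∀ g, MeasurableSet {ω | g ∈ Wω ω}) (n : ℕ)
    {c : Ω → G → Fin 2} (hc : ∀ g, Measurable fun ω => c ω g)
    (b g : G) : Measurable fun ω => coinLevel b (Wω ω) n (c ω) g := by
  induction n generalizing c with
  | zero => exact hc g
  | succ n ih =>
    exact ih fun g => Measurable.add (M := Fin 2) (hc g) (measurable_comp_nextHit hW hc b g)

lemma measurable_seed (hW : ∀ g, MeasurableSet {ω | g ∈ Wω ω})
    {c : Ω → G → Fin 2} (hc : ∀ g, Measurable fun ω => c ω g) (a b g : G) :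
    Measurable fun ω => seed a b (Wω ω) (c ω) g := by
  refine measurable_pi_iff.2 fun j => ?_
  refine Measurable.eval_nat (F := fun i ω => coinBit a b (Wω ω) (c ω) (Nat.pair i j) (g * b ^ i))
    (measurable_sInf_nat (P := fun ω => {i : ℕ | g * b ^ i ∈ Wω ω}) fun i => hW _) fun i => ?_
  exact Measurable.add (M := Fin 2) (measurable_coinLevel hW _ hc b _)
    (measurable_comp_nextHit hW (fun g => measurable_coinLevel hW _ hc b g) a _)

end Measurability

section Law

lemma map_add_infinitePi_fairCoin {ι : Type*} (c₀ : ι → Fin 2) :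
    (Measure.infinitePi fun _ : ι => fairCoin).map (fun c => c₀ + c) =
      Measure.infinitePi fun _ : ι => fairCoin := by
  have := Measure.infinitePi_map_pi (fun _ : ι => fairCoin) (f := fun i u => c₀ i + u)
    (fun i => by fun_prop)
  simp only [map_add_fairCoin] at this
  exact this

/-- An additive map between spaces of bit families that is onto on finite sets of coordinates
maps fair coins to fair coins. -/
lemma map_infinitePi_fairCoin_of_additive {ι I : Type*} {V : (ι → Fin 2) → I → Fin 2}
    (hV : Measurable V) (hadd : ∀ c c', V (c + c') = V c + V c')
    (hsurj : ∀ (s : Finset I) (v : I → Fin 2), ∃ c, ∀ i ∈ s, V c i = v i) :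
    (Measure.infinitePi fun _ : ι => fairCoin).map V = Measure.infinitePi fun _ : I => fairCoin := by
  classical
  set m := Measure.infinitePi fun _ : ι => fairCoin with hm
  have key : ∀ s : Finset I, (m.map V).map s.restrict = Measure.pi fun _ : s => fairCoin := by
    intro s
    have hVs : Measurable fun c => s.restrict (V c) := by fun_prop
    rw [Measure.map_map (by fun_prop) hV]
    change m.map (fun c => s.restrict (V c)) = _
    set P := m.map (fun c => s.restrict (V c)) with hP
    have : IsProbabilityMeasure P := Measure.isProbabilityMeasure_map hVs.aemeasurable
    -- Translation by a preimage of `v` preserves the coins and carries one fibre to the other, so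
    -- the finite marginals are uniform.
    have hconst : ∀ v : s → Fin 2, P {v} = P {0} := by
      intro v
      obtain ⟨c₀, hc₀⟩ := hsurj s fun i => if h : i ∈ s then v ⟨i, h⟩ else 0
      rw [hP, Measure.map_apply hVs (measurableSet_singleton v),
        Measure.map_apply hVs (measurableSet_singleton 0)]
      conv_lhs => rw [hm, ← map_add_infinitePi_fairCoin c₀]
      rw [Measure.map_apply (by fun_prop) (hVs (measurableSet_singleton v))]
      congr 1
      ext c
      simp only [Set.mem_preimage, Set.mem_singleton_iff, hadd, funext_iff, Finset.restrict,
        Pi.add_apply, Pi.zero_apply]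
      refine forall_congr' fun i => ?_
      rw [hc₀ i i.2]
      simp
    have hsum : ∑ v : s → Fin 2, P {v} = 1 := by
      rw [sum_measure_singleton]
      simp
    simp only [hconst, Finset.sum_const, Finset.card_univ, Fintype.card_fun, Fintype.card_fin,
      Fintype.card_coe, nsmul_eq_mul, Nat.cast_pow, Nat.cast_ofNat] at hsum
    refine Measure.ext_of_singleton fun v => ?_
    rw [hconst, Measure.pi_singleton]
    simp only [fairCoin_singleton, Finset.prod_const, Finset.card_univ, Fintype.card_coe]
    rw [← ENNReal.inv_pow]
    exact ENNReal.eq_inv_of_mul_eq_one_left (by rw [mul_comm]; exact hsum)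
  refine Measure.eq_infinitePi _ fun s t ht => ?_
  have h1 : Set.pi (s : Set I) t = s.restrict ⁻¹' Set.pi Set.univ fun i : s => t i := by
    ext v
    simp
  rw [h1, ← Measure.map_apply (by fun_prop) (MeasurableSet.univ_pi fun i : s => ht i), key,
    Measure.pi_pi]
  exact Finset.prod_coe_sort s fun i => fairCoin (t i)

variable {S : Type*}

/-- The seeds are additive in the coins and can be prescribed on finite sets, hence are fair; the
shift `c₀` is harmless. In the application `c₀` holds the coins already present in `x`. -/
lemma map_seed {s₀ s₁ : S} (hs : s₀ ≠ s₁) {W N : Set (FreeGroup S)}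
    (hN₀ : ∀ g ∈ N, ∀ i : ℕ, g * FreeGroup.of s₀ ^ i ∈ N)
    (hN₁ : ∀ g ∈ N, ∀ i : ℕ, g * FreeGroup.of s₁ ^ i ∈ N)
    (h₀ : ∀ g ∈ N, ∃ i : ℕ, g * FreeGroup.of s₀ ^ (i + 1) ∈ W)
    (h₁ : ∀ g ∈ N, ∃ i : ℕ, g * FreeGroup.of s₁ ^ (i + 1) ∈ W)
    (c₀ : FreeGroup S → Fin 2) :
    (Measure.infinitePi fun _ : FreeGroup S => fairCoin).map
      (fun c (g : N) => seed (FreeGroup.of s₀) (FreeGroup.of s₁) W (c₀ + c) g) =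
      Measure.infinitePi fun _ : N => Measure.infinitePi fun _ : ℕ => fairCoin := by
  set V : (FreeGroup S → Fin 2) → N × ℕ → Fin 2 := fun c p =>
    seed (FreeGroup.of s₀) (FreeGroup.of s₁) W c p.1 p.2 with hVdef
  have hV : Measurable V := by
    refine measurable_pi_iff.2 fun p => ?_
    exact (measurable_pi_apply p.2).comp (measurable_seed (Wω := fun _ => W)
      (c := fun c => c) (fun g => MeasurableSet.const _) (fun g => measurable_pi_apply g) _ _ _)
  have hlaw : (Measure.infinitePi fun _ : FreeGroup S => fairCoin).map V =
      Measure.infinitePi fun _ : N × ℕ => fairCoin := by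
    refine map_infinitePi_fairCoin_of_additive hV (fun c c' => funext fun p => seed_add _ _ _ _)
      fun s v => ?_
    let τ : N → ℕ := fun g => hitTime (FreeGroup.of s₁) W g
    let e : N × ℕ → ℕ × FreeGroup S := fun p =>
      (Nat.pair (τ p.1) p.2, p.1 * FreeGroup.of s₁ ^ τ p.1)
    -- Sites that share a hit point are told apart by their hitting times, so no bit is used twice.
    have he : Function.Injective e := by
      rintro ⟨g, j⟩ ⟨g', j'⟩ h
      obtain ⟨h1, h2⟩ := Prod.mk.inj h
      obtain ⟨h3, rfl⟩ := Nat.pair_eq_pair.1 h1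
      simp only [h3, mul_left_inj] at h2
      rw [Subtype.ext h2]
    obtain ⟨c, hc⟩ := exists_coins_coinBit hs (W := W) (M := W ∩ N) Set.inter_subset_left
      (fun w hw => h₀ w hw.2) (fun w hw => h₁ w hw.2)
      (fun w hw => ⟨nextHit_mem (h₀ w hw.2), hN₀ w hw.2 _⟩)
      (fun w hw => ⟨nextHit_mem (h₁ w hw.2), hN₁ w hw.2 _⟩)
      (s.sup (fun p => (e p).1) + 1) (fun n w => Function.extend e v 0 (n, w))
    refine ⟨c, fun p hp => ?_⟩
    have hW : (e p).2 ∈ W := by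
      obtain ⟨i, hi⟩ := h₁ p.1 p.1.2
      exact mul_pow_hitTime_mem ⟨i + 1, hi⟩
    have := hc (e p).1 (Nat.lt_succ_of_le (Finset.le_sup (f := fun p => (e p).1) hp)) (e p).2
      ⟨hW, hN₁ _ p.1.2 _⟩
    rw [Prod.mk.eta, he.extend_apply] at this
    exact this
  rw [← Measure.infinitePi_map_curry (fun _ : N => fun _ : ℕ => fairCoin), ← hlaw,
    Measure.map_map (by fun_prop) hV]
  conv_rhs => rw [← map_add_infinitePi_fairCoin c₀]
  rw [Measure.map_map ((MeasurableEquiv.measurable _).comp hV) (by fun_prop)]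
  rfl

end Law

end Seed

/-! ### Equivariance and the final map -/

section Equivariance

variable {G R : Type*} [Group G] {a b : G} {k : ℕ}

lemma isMarked_translate (g h : G) (x : G → Fin 2) :
    IsMarked a k (fun f => x (g * f)) h ↔ IsMarked a k x (g * h) := by
  simp only [IsMarked, mul_assoc]

lemma isSwitch_translate (g h : G) (x : G → Fin 2) :
    IsSwitch a k (fun f => x (g * f)) h ↔ IsSwitch a k x (g * h) := by
  simp only [IsSwitch, isMarked_translate, mul_assoc]

lemma siteThin_translate (A : Set R) (g f : G) (ω : G → Fin 2 × R) :
    siteThin A (fun f => ω (g * f)) f = siteThin A ω (g * f) := rfl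

lemma isToggle_translate (A T : Set R) (g h : G) (ω : G → Fin 2 × R) (β : Bool) :
    IsToggle a k A T (fun f => ω (g * f)) h β ↔ IsToggle a k A T ω (g * h) β := by
  simp only [IsToggle, IsKept, IsRemoved, siteThin_translate,
    isMarked_translate g h fun f => (ω f).1, mul_assoc]

lemma thin_translate (A T : Set R) (g f : G) (ω : G → Fin 2 × R) :
    thin a k A T Set.univ (fun f => ω (g * f)) f = thin a k A T Set.univ ω (g * f) := by
  unfold thin
  congr 1
  refine Finset.sum_congr rfl fun β _ => ?_
  congr 1
  rw [eq_iff_iff]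
  simp only [isToggle_translate, Set.mem_univ, true_and, mul_assoc]

lemma nextHit_translate (g f : G) (W : Set G) :
    g * nextHit b {f | g * f ∈ W} f = nextHit b W (g * f) := by
  simp only [nextHit, Set.mem_ofPred_eq, mul_assoc]

lemma coinLevel_translate (g f : G) (W : Set G) (n : ℕ) (c : G → Fin 2) :
    coinLevel b {f | g * f ∈ W} n (fun f => c (g * f)) f = coinLevel b W n c (g * f) := by
  induction n generalizing c with
  | zero => rfl
  | succ n ih =>
    simp only [coinLevel]
    rw [← ih]
    simp only [nextHit_translate]

lemma seed_translate (g f : G) (W : Set G) (c : G → Fin 2) :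
    seed a b {f | g * f ∈ W} (fun f => c (g * f)) f = seed a b W c (g * f) := by
  have h : hitTime b {f | g * f ∈ W} f = hitTime b W (g * f) := by
    simp only [hitTime, Set.mem_ofPred_eq, mul_assoc]
  ext1 j
  simp only [seed, coinBit, h, coinLevel_translate, nextHit_translate, mul_assoc]

lemma seed_congr {W M : Set G} (hMa : ∀ w ∈ M, nextHit a W w ∈ M)
    (hMb : ∀ w ∈ M, nextHit b W w ∈ M) {c c' : G → Fin 2} (e : ∀ w ∈ M, c w = c' w) {g : G}
    (hg : g * b ^ hitTime b W g ∈ M) : seed a b W c g = seed a b W c' g := by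
  ext1 j
  rw [seed, seed, coinBit, coinBit, coinLevel_congr hMb e _ _ hg,
    coinLevel_congr hMb e _ _ (hMa _ hg)]

/-- The thinning that uses labels generated by the coins at the switches. -/
noncomputable def coinThinning (a b : G) (k : ℕ) (A T : Set (ℕ → Fin 2)) (x : G → Fin 2) :
    G → Fin 2 :=
  thin a k A T Set.univ fun g =>
    (x g, seed a b {h | IsSwitch a k x h} (fun h => x (h * a ^ src k false)) g)

variable {A T : Set (ℕ → Fin 2)}

lemma coinThinning_shift (g : G) (x : G → Fin 2) :
    coinThinning a b k A T (shift g x) = shift g (coinThinning a b k A T x) := by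
  have hW : {h | IsSwitch a k (shift g x) h} = {h | g⁻¹ * h ∈ {h | IsSwitch a k x h}} := by
    ext h
    exact isSwitch_translate g⁻¹ h x
  ext1 f
  change _ = coinThinning a b k A T x (g⁻¹ * f)
  unfold coinThinning
  rw [← thin_translate, hW]
  congr 1
  ext1 f
  rw [← seed_translate]
  simp only [shift, mul_assoc]

lemma measurable_coinThinning (hA : MeasurableSet A) (hT : MeasurableSet T) :
    Measurable (coinThinning a b k A T) := by
  refine (measurable_thin hA hT _).comp (measurable_pi_iff.2 fun g => ?_)
  refine (measurable_pi_apply g).prodMk (measurable_seed (fun h => ?_) (fun h => ?_) a b g)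
  · exact measurableSet_isSwitch h
  · exact measurable_pi_apply _

end Equivariance

/-! ### Resampling the coins over the free group -/

section FreeGroup

variable {S : Type*} {s₀ s₁ : S}

lemma injective_pow_mul_pow (hs : s₀ ≠ s₁) : Function.Injective fun p : ℕ × ℕ =>
    (FreeGroup.of s₁ ^ p.1 * FreeGroup.of s₀ ^ p.2 : FreeGroup S) := by
  classical
  let π : FreeGroup S →* Multiplicative (ℤ × ℤ) := FreeGroup.lift fun s =>
    Multiplicative.ofAdd (if s = s₁ then (1, 0) else if s = s₀ then (0, 1) else 0)
  rintro ⟨i, j⟩ ⟨i', j'⟩ h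
  have := congrArg (fun g => (π g).toAdd) h
  simpa [π, hs] using this

lemma injective_pow (s : S) : Function.Injective fun i : ℕ => (FreeGroup.of s ^ i : FreeGroup S) := by
  let π : FreeGroup S →* Multiplicative ℤ := FreeGroup.lift fun s => Multiplicative.ofAdd 1
  intro i j h
  have := congrArg (fun g => (π g).toAdd) h
  simpa [π] using this

lemma ae_exists_isSwitch_of (κ : Measure (Fin 2)) [IsProbabilityMeasure κ] (h0 : κ {0} ≠ 0)
    (h1 : κ {1} ≠ 0) (hs : s₀ ≠ s₁) (k : ℕ) (g : FreeGroup S) :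
    ∀ᵐ x ∂(Measure.infinitePi fun _ : FreeGroup S => κ),
      (∃ i : ℕ, IsSwitch (FreeGroup.of s₀) k x (g * FreeGroup.of s₀ ^ (i + 1))) ∧
      ∃ i : ℕ, IsSwitch (FreeGroup.of s₀) k x (g * FreeGroup.of s₁ ^ (i + 1)) := by
  have A := ae_exists_isSwitch (k := k) (a := FreeGroup.of s₀) κ h0 h1
    -- Along the `s₀`-ray, steps of the window length keep the windows disjoint; along the `s₁`-ray
    -- they are disjoint anyway.
    (fun j => g * FreeGroup.of s₀ ^ ((2 * k + 7) * j + 1)) (by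
      rintro ⟨i, j⟩ ⟨i', j'⟩ h
      simp only [mul_assoc, ← pow_add] at h
      have h := injective_pow s₀ (mul_left_cancel h)
      have hj := j.2
      have hj' := j'.2
      have e : (2 * k + 7) * i + j = (2 * k + 7) * i' + j' := by omega
      have e1 := congrArg (· / (2 * k + 7)) e
      simp only [Nat.mul_add_div (show 2 * k + 7 > 0 by omega), Nat.div_eq_of_lt hj,
        Nat.div_eq_of_lt hj', add_zero] at e1
      subst e1
      simpa [Fin.ext_iff] using e)
  have B := ae_exists_isSwitch (k := k) (a := FreeGroup.of s₀) κ h0 h1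
    (fun j => g * FreeGroup.of s₁ ^ (j + 1)) (by
      rintro ⟨i, j⟩ ⟨i', j'⟩ h
      simp only [mul_assoc] at h
      have h := Prod.mk.inj (injective_pow_mul_pow hs
        (a₁ := (i + 1, (j : ℕ))) (a₂ := (i' + 1, (j' : ℕ))) (mul_left_cancel h))
      simpa [Fin.ext_iff] using h)
  filter_upwards [A, B] with x hA hB
  obtain ⟨j, hj⟩ := hA
  exact ⟨⟨_, hj⟩, hB⟩

/-- Flipping by `c` keeps the switches and adds `c` to their coins. So it acts only through the
labels, the configuration entering `thin` being replaceable by `x`. -/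
lemma coinThinning_coinFlip {x : FreeGroup S → Fin 2} {k : ℕ} {A T : Set (ℕ → Fin 2)}
    {H : Subgroup (FreeGroup S)} (h₀ : FreeGroup.of s₀ ∈ H) (h₁ : FreeGroup.of s₁ ∈ H)
    {N : Set (FreeGroup S)} (hN : ∀ g ∈ N, ∀ h ∈ H, g * h ∈ N)
    (hx : ∀ g ∈ N, (∃ i : ℕ, IsSwitch (FreeGroup.of s₀) k x (g * FreeGroup.of s₀ ^ (i + 1))) ∧
      ∃ i : ℕ, IsSwitch (FreeGroup.of s₀) k x (g * FreeGroup.of s₁ ^ (i + 1)))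
    (c : FreeGroup S → Fin 2) {u : FreeGroup S → ℕ → Fin 2}
    (hu : ∀ g ∈ N, u g = seed (FreeGroup.of s₀) (FreeGroup.of s₁)
      {h | IsSwitch (FreeGroup.of s₀) k x h}
      ((fun h => x (h * FreeGroup.of s₀ ^ src k false)) + c) g) {g : FreeGroup S} (hg : g ∈ N) :
    coinThinning (FreeGroup.of s₀) (FreeGroup.of s₁) k A T (coinFlip (FreeGroup.of s₀) k x c) g =
      thin (FreeGroup.of s₀) k A T Set.univ (fun g => (x g, u g)) g := by
  have ha := injective_pow s₀
  unfold coinThinning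
  rw [thin_coinFlip ha]
  refine thin_congr_of_subgroup H h₀ fun h hh => ?_
  have hgN := hN g hg h hh
  congr 1
  rw [hu _ hgN]
  simp only [isSwitch_coinFlip ha]
  set W : Set (FreeGroup S) := {h | IsSwitch (FreeGroup.of s₀) k x h}
  refine seed_congr (M := W ∩ N)
    (fun w hw => ⟨nextHit_mem (hx w hw.2).1, hN w hw.2 _ (H.pow_mem h₀ _)⟩)
    (fun w hw => ⟨nextHit_mem (hx w hw.2).2, hN w hw.2 _ (H.pow_mem h₁ _)⟩)
    (fun w hw => coinFlip_mul_pow_src ha c hw.1 false) ⟨?_, hN _ hgN _ (H.pow_mem h₁ _)⟩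
  obtain ⟨i, hi⟩ := (hx _ hgN).2
  exact mul_pow_hitTime_mem ⟨i + 1, hi⟩

lemma map_coinThinning (κ : Measure (Fin 2)) [IsProbabilityMeasure κ] (h0 : κ {0} ≠ 0)
    (h1 : κ {1} ≠ 0) (hs : s₀ ≠ s₁) {k : ℕ} {A T : Set (ℕ → Fin 2)} (hA : MeasurableSet A)
    (hT : MeasurableSet T) {ι : Measure (Fin 2)} [IsProbabilityMeasure ι]
    (hthin : (Measure.infinitePi fun _ : FreeGroup S =>
      κ.prod (Measure.infinitePi fun _ : ℕ => fairCoin)).map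
        (thin (FreeGroup.of s₀) k A T Set.univ) = Measure.infinitePi fun _ : FreeGroup S => ι) :
    (Measure.infinitePi fun _ : FreeGroup S => κ).map
      (coinThinning (FreeGroup.of s₀) (FreeGroup.of s₁) k A T) =
      Measure.infinitePi fun _ : FreeGroup S => ι := by
  classical
  have ha := injective_pow s₀
  set a := FreeGroup.of s₀ with ha_def
  set b := FreeGroup.of s₁ with hb_def
  set ρ := Measure.infinitePi fun _ : ℕ => fairCoin
  refine Measure.eq_infinitePi _ fun s t ht => ?_
  have hB : MeasurableSet (Set.pi (s : Set (FreeGroup S)) t) :=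
    MeasurableSet.pi s.countable_toSet fun i _ => ht i
  -- The countable subgroup generated by `a` and `b`. Its cosets through `s` carry all the relevant
  -- data, so the hitting property holds almost surely at all their points at once.
  let H : Subgroup (FreeGroup S) := (FreeGroup.lift fun β : Bool => bif β then b else a).range
  have haH : a ∈ H := ⟨FreeGroup.of false, by simp⟩
  have hbH : b ∈ H := ⟨FreeGroup.of true, by simp⟩
  have hHc : (H : Set (FreeGroup S)).Countable := by
    rw [MonoidHom.coe_range]
    exact Set.countable_range _
  let N : Set (FreeGroup S) := ⋃ j ∈ s, (fun h => j * h) '' (H : Set (FreeGroup S))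
  have hNc : N.Countable := s.countable_toSet.biUnion fun j _ => hHc.image _
  have hN : ∀ g ∈ N, ∀ h ∈ H, g * h ∈ N := by
    intro g hg h hh
    simp only [N, Set.mem_iUnion] at hg ⊢
    obtain ⟨j, hj, f, hf, rfl⟩ := hg
    exact ⟨j, hj, f * h, H.mul_mem hf hh, (mul_assoc _ _ _).symm⟩
  have hsN : ∀ g ∈ s, g ∈ N := by
    intro g hg
    simp only [N, Set.mem_iUnion]
    exact ⟨g, hg, 1, H.one_mem, mul_one g⟩
  have hae : ∀ᵐ x ∂(Measure.infinitePi fun _ : FreeGroup S => κ), ∀ g ∈ N,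
      (∃ i : ℕ, IsSwitch a k x (g * a ^ (i + 1))) ∧
        ∃ i : ℕ, IsSwitch a k x (g * b ^ (i + 1)) :=
    (ae_ball_iff hNc).2 fun g _ => ae_exists_isSwitch_of κ h0 h1 hs k g
  have hφ := measurable_coinThinning (a := a) (b := b) (k := k) hA hT
  have hth := measurable_thin (a := a) (k := k) hA hT Set.univ
  have hzip : Measurable fun (p : (FreeGroup S → Fin 2) × (FreeGroup S → ℕ → Fin 2)) g =>
    (p.1 g, p.2 g) := by fun_prop
  rw [← Measure.infinitePi_pi (fun _ : FreeGroup S => ι) (fun i _ => ht i), ← hthin,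
    Measure.map_apply hφ hB, Measure.map_apply hth hB, ← map_zip_infinitePi,
    Measure.map_apply hzip (hth hB), Measure.prod_apply (hzip (hth hB))]
  -- Replace `x` by its flip with fresh fair coins; it then suffices to compare the two sides for
  -- almost every fixed `x`.
  conv_lhs => rw [← map_coinFlip_prod (k := k) κ ha (Measure.infinitePi fun _ => fairCoin)]
  rw [Measure.map_apply measurable_coinFlip (hφ hB),
    Measure.prod_apply (measurable_coinFlip (hφ hB))]
  refine lintegral_congr_ae ?_
  filter_upwards [hae] with x hx
  let ext : (N → ℕ → Fin 2) → FreeGroup S → ℕ → Fin 2 := fun v g =>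
    if h : g ∈ N then v ⟨g, h⟩ else 0
  have hext : Measurable ext := by
    refine measurable_pi_iff.2 fun g => ?_
    by_cases h : g ∈ N
    · simp only [ext, dif_pos h]
      exact measurable_pi_apply _
    · simp only [ext, dif_neg h]
      exact measurable_const
  let Q : Set (N → ℕ → Fin 2) :=
    {v | thin a k A T Set.univ (fun g => (x g, ext v g)) ∈ Set.pi (s : Set (FreeGroup S)) t}
  have hQ : MeasurableSet Q := by
    refine hth.comp (measurable_pi_iff.2 fun g => ?_) hB
    exact measurable_const.prodMk ((measurable_pi_apply g).comp hext)
  have hmem : ∀ y y' : FreeGroup S → Fin 2, (∀ g ∈ N, y g = y' g) →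
      (y ∈ Set.pi (s : Set (FreeGroup S)) t ↔ y' ∈ Set.pi (s : Set (FreeGroup S)) t) := by
    intro y y' h
    exact forall₂_congr fun g hg => by rw [h g (hsN g hg)]
  have hseed : Measurable fun c (g : N) => seed a b {h | IsSwitch a k x h}
      ((fun h => x (h * a ^ src k false)) + c) g := by
    refine measurable_pi_iff.2 fun g => ?_
    exact measurable_seed (Wω := fun _ => {h | IsSwitch a k x h}) (fun g => MeasurableSet.const _)
      (c := fun c => (fun h => x (h * a ^ src k false)) + c)
      (fun g => measurable_const.add (measurable_pi_apply g)) _ _ _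
  have hlaw := map_seed hs (W := {h | IsSwitch a k x h}) (N := N)
    (fun g hg i => hN g hg _ (H.pow_mem haH i)) (fun g hg i => hN g hg _ (H.pow_mem hbH i))
    (fun g hg => (hx g hg).1) (fun g hg => (hx g hg).2) (fun h => x (h * a ^ src k false))
  have hres := Measure.infinitePi_map_restrict' (fun _ : FreeGroup S => ρ) (I := N)
  trans (Measure.infinitePi fun _ : N => ρ) Q
  · rw [← hlaw, Measure.map_apply hseed hQ]
    congr 1
    ext c
    refine hmem _ _ fun g hg => ?_
    exact coinThinning_coinFlip haH hbH hN hx c (fun g hg => dif_pos hg) hg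
  · rw [← hres, Measure.map_apply (by fun_prop) hQ]
    congr 1
    ext u
    refine hmem _ _ fun g hg => ?_
    refine thin_congr_of_subgroup H haH fun h hh => ?_
    have : ext (N.domRestrict u) (g * h) = u (g * h) := dif_pos (hN g hg h hh)
    rw [this]

end FreeGroup

/-! ### Choice of the parameters and conclusion -/

section Parameters

lemma measure_fin_two_ext {μ ν : Measure (Fin 2)} [IsProbabilityMeasure μ]
    [IsProbabilityMeasure ν] (h : μ {1} = ν {1}) : μ = ν := by
  have hc : ({1} : Set (Fin 2))ᶜ = {0} := by ext i; fin_cases i <;> simp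
  refine Measure.ext_of_singleton fun i => ?_
  fin_cases i
  · change μ {0} = ν {0}
    rw [← hc, prob_compl_eq_one_sub (measurableSet_singleton _),
      prob_compl_eq_one_sub (measurableSet_singleton _), h]
  · exact h

lemma exists_pow_sub_pow_ge {p q : ℝ} (hq : 0 ≤ q) (hqp : q < p) (hp : p < 1) :
    ∃ k : ℕ, 0 < (p - q) * ((1 - q) ^ k - (1 - p) ^ k) ∧
      q * (1 - p) ^ k ≤ (p - q) * ((1 - q) ^ k - (1 - p) ^ k) := by
  have h1 : 0 < 1 - q := by linarith
  have h2 : 0 < 1 - p := by linarith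
  have hr : (1 - p) / (1 - q) < 1 := by rw [div_lt_one h1]; linarith
  -- For this `k`, `p * (1 - p) ^ k ≤ (1 - p) ^ k < (p - q) * (1 - q) ^ k`, which rearranges to the
  -- claim.
  obtain ⟨k, hk⟩ := exists_pow_lt_of_lt_one (show 0 < (p - q) by linarith) hr
  rw [div_pow, div_lt_iff₀ (pow_pos h1 k)] at hk
  have h3 : 0 < (1 - p) ^ k := pow_pos h2 k
  have h4 : q * (1 - p) ^ k < (p - q) * ((1 - q) ^ k - (1 - p) ^ k) := by nlinarith
  exact ⟨k, lt_of_le_of_lt (by positivity) h4, h4.le⟩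

end Parameters

theorem theorem1 {S : Type*} [Nontrivial S] (κ ι : Measure (Fin 2))
    [IsProbabilityMeasure κ] [IsProbabilityMeasure ι]
    (hκ : intensity κ < 1) (hικ : intensity ι < intensity κ) :
    ∃ φ : (FreeGroup S → Fin 2) → (FreeGroup S → Fin 2), IsEquivariantThinning κ ι φ := by
  obtain ⟨s₀, s₁, hs⟩ := exists_pair_ne S
  set p := intensity κ with hp
  set q := intensity ι with hq
  have hq0 : 0 ≤ q := measureReal_nonneg
  have hp0 : 0 < p := hq0.trans_lt hικ
  have hc : ({1} : Set (Fin 2))ᶜ = {0} := by ext i; fin_cases i <;> simp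
  have hκ1 : κ {1} = ENNReal.ofReal p := by simp [hp, intensity]
  have hι1 : ι {1} = ENNReal.ofReal q := by simp [hq, intensity]
  have hκ0 : κ {0} = ENNReal.ofReal (1 - p) := by
    rw [← hc, prob_compl_eq_one_sub (measurableSet_singleton _), hκ1,
      ENNReal.ofReal_sub _ hp0.le, ENNReal.ofReal_one]
  obtain ⟨k, hk0, hk⟩ := exists_pow_sub_pow_ge hq0 hικ hκ
  have h1p : 0 ≤ 1 - p := by linarith
  obtain ⟨A, hA, hAr⟩ := exists_measurableSet_measureReal_eq
    (Measure.infinitePi fun _ : ℕ => fairCoin) (div_nonneg hq0 hp0.le)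
    ((div_le_one hp0).2 hικ.le)
  -- The measure of `T` solves the balance equation `hbal`; the choice of `k` makes it at most one.
  obtain ⟨T, hT, hTr⟩ := exists_measurableSet_measureReal_eq
    (Measure.infinitePi fun _ : ℕ => fairCoin)
    (div_nonneg (mul_nonneg hq0 (pow_nonneg h1p k)) hk0.le) ((div_le_one hk0).2 hk)
  set ρ := Measure.infinitePi fun _ : ℕ => fairCoin
  have hρA : ρ A = ENNReal.ofReal (q / p) := by simp [← hAr]
  have hρA' : ρ Aᶜ = ENNReal.ofReal (1 - q / p) := by
    rw [prob_compl_eq_one_sub hA, hρA, ENNReal.ofReal_sub _ (div_nonneg hq0 hp0.le),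
      ENNReal.ofReal_one]
  have hκA : κ {1} * ρ A = ENNReal.ofReal q := by
    rw [hκ1, hρA, ← ENNReal.ofReal_mul hp0.le, mul_div_cancel₀ _ hp0.ne']
  have hsub : (1 - κ {1} * ρ A) ^ k - κ {0} ^ k =
      ENNReal.ofReal ((1 - q) ^ k - (1 - p) ^ k) := by
    rw [hκA, hκ0, ENNReal.ofReal_sub _ (pow_nonneg h1p k),
      ENNReal.ofReal_pow (by linarith), ENNReal.ofReal_pow h1p, ENNReal.ofReal_sub _ hq0,
      ENNReal.ofReal_one]
  have hT' : ρ T = ENNReal.ofReal (q * (1 - p) ^ k / ((p - q) * ((1 - q) ^ k - (1 - p) ^ k))) := by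
    simp [← hTr]
  have hd : 0 < (1 - q) ^ k - (1 - p) ^ k := (pos_iff_pos_of_mul_pos hk0).1 (by linarith)
  have hbal : κ {1} * ρ A * (κ {0} * κ {0} ^ k) = κ {1} * ρ Aᶜ * (κ {0} * ρ T *
      ((1 - κ {1} * ρ A) ^ k - κ {0} ^ k)) := by
    have hr : 0 ≤ 1 - q / p := by
      rw [sub_nonneg, div_le_one hp0]; exact hικ.le
    have ht : 0 ≤ q * (1 - p) ^ k / ((p - q) * ((1 - q) ^ k - (1 - p) ^ k)) :=
      div_nonneg (mul_nonneg hq0 (pow_nonneg h1p k)) hk0.le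
    rw [hsub, hκA, hκ0, hκ1, hρA', hT', ← ENNReal.ofReal_pow h1p, ← ENNReal.ofReal_mul h1p,
      ← ENNReal.ofReal_mul hq0, ← ENNReal.ofReal_mul hp0.le, ← ENNReal.ofReal_mul h1p,
      ← ENNReal.ofReal_mul (mul_nonneg h1p ht), ← ENNReal.ofReal_mul (mul_nonneg hp0.le hr)]
    congr 1
    have : p - q ≠ 0 := by linarith
    field_simp
  have hιlaw : (κ.prod ρ).map (fun e => siteThin A (fun _ : Unit => e) ()) = ι := by
    have hm : Measurable fun e : Fin 2 × (ℕ → Fin 2) => siteThin A (fun _ : Unit => e) () :=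
      ((measurable_pi_apply ()).comp (measurable_siteThin hA)).comp
        (measurable_pi_iff.2 fun _ => measurable_id)
    have : IsProbabilityMeasure ((κ.prod ρ).map (fun e => siteThin A (fun _ : Unit => e) ())) :=
      Measure.isProbabilityMeasure_map hm.aemeasurable
    refine measure_fin_two_ext ?_
    rw [Measure.map_apply hm (measurableSet_singleton _), hι1, ← hκA, ← Measure.prod_prod]
    congr 1
    ext e
    simp [siteThin]
  have hthin := map_thin_univ (G := FreeGroup S) (a := FreeGroup.of s₀) (k := k) (A := A) (T := T)
    (κ.prod ρ) (injective_pow s₀) hA hT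
    (measure_isKept_eq_isRemoved κ ρ (injective_pow s₀) hA hT hbal) hιlaw
  refine ⟨coinThinning (FreeGroup.of s₀) (FreeGroup.of s₁) k A T,
    measurable_coinThinning hA hT, fun x g => thin_le g, ?_,
    Filter.Eventually.of_forall fun x g => coinThinning_shift g x⟩
  refine map_coinThinning κ ?_ ?_ hs hA hT hthin
  · rw [hκ0]
    exact (ENNReal.ofReal_pos.2 (by linarith)).ne'
  · rw [hκ1]
    exact (ENNReal.ofReal_pos.2 hp0).ne'
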